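/- **Setting.** Let $(\mathcal M,\otimes,I)$ be a strict Markov category containing a full monoidal subcategory $\mathcal P$ of the category of measurable spaces and Markov kernels, such that every standard Borel space lies in $\mathcal P$ (the inclusion is symmetric monoidal and preserves copying). Write $\mathcal M_{det}$ for the deterministic (copy-preserving) morphisms of $\mathcal M$ and $\mathrm{del}$ for the discard maps. A *joint Markov kernel* $([R,k],f)\colon Z\to X$ consists of an object $R$ (the residual), a deterministic mechanism $k\colon R\otimes Z\to X$ and a noise kernel $f\colon Z\to R$. Joint Markov kernels compose by $k(r,r',z)=k_2(r',k_1(r,z))$, with noise sampling $r$ from $f_1(z)$ and then $r'$ from $f_2(k_1(r,z))$, and are tensored by pairing mechanisms and noises. Identifying $([R,k],f)$ with $([R',k'],f')$ whenever some deterministic $\rho\colon R\to R'$ satisfies $f'=\rho\circ f$ and $k=k'\circ(\rho\otimes\mathrm{id})$ gives a strict Markov category $\mathrm{Joint}(\mathcal M)$ on the objects of $\mathcal M$. A deterministic $h\colon Z\to X$ is regarded as the joint kernel with residual $I$ and mechanism $h$. Let $\Sigma$ be a monoidal signature: sets $W$ of wires and $B$ of boxes, each box $b$ having a domain $\mathrm{dom}(b)\in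 W^*$ and a codomain $\mathrm{cod}(b)\in W^*$. Let $\mathrm{FreeMarkov}(\Sigma)$ be the free strict Markov category on $\Sigma$, with objects $W^*$. A *joint factorization* $(f,\varphi,F)$ over $\Sigma$ consists of a labelling $r\colon B\to W^*$, a strict Markov functor $F\colon\mathrm{FreeMarkov}(\Sigma)\to\mathrm{Joint}(\mathcal M)$ with, for each box $b$, a presentation $$F(b)=([F(r(b)),k_b],f_b)\colon F(\mathrm{dom}(b))\to F(\mathrm{cod}(b)),$$ and a morphism $\varphi$ of $\mathrm{FreeMarkov}(\Sigma)$ with $f=F(\varphi)$. **Theorem.** Let $(f,\varphi,F)$ be a joint factorization over $\Sigma$ such that each noise kernel $f_b$ is, up to deterministic isomorphisms of its domain and codomain, a Markov kernel from an object of $\mathcal P$ to a standard Borel space. Then: 1. The noise of each box is a pushforward of the uniform distribution: there are deterministic $g_b\colon[0,1]\otimes F(\mathrm{dom}(b))\to F(r(b))$, $b\in B$, such that $f_b$ is $z\mapsto g_b(u,z)$ with $u$ drawn uniformly from $[0,1]$. 2. Fix any such family $(g_b)_{b\in B}$. For every intervention $\mathbf{do}\in\prod_{b\in B}\bigl(\{*\}\sqcup\mathcal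 M_{det}(I,F(\mathrm{cod}(b)))\bigr)$ and every assignment $U\colon B\to[0,1]$ of uniform variates to boxes, there is a unique strict Markov functor $\mathrm{If}\colon\mathrm{FreeMarkov}(\Sigma)\to\mathrm{Joint}(\mathcal M)$ which agrees with $F$ on objects and satisfies, for every box $b$, $$\mathrm{If}(b)=\begin{cases}x\circ\mathrm{del}_{F(\mathrm{dom}(b))} & \text{if }\mathbf{do}(b)=x\in\mathcal M_{det}(I,F(\mathrm{cod}(b))),\\ \bigl([F(r(b)),k_b],\,g_b(U(b),\cdot)\bigr) & \text{if }\mathbf{do}(b)=*.\end{cases}$$ Consequently $\mathbf{do}$ and $U$ determine a unique counterfactual joint distribution $\mathrm{If}(\varphi)\colon F(\mathrm{dom}(\varphi))\to F(\mathrm{cod}(\varphi))$ in $\mathrm{Joint}(\mathcal M)$. -/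

import Mathlib

open CategoryTheory MonoidalCategory
open scoped ComonObj

namespace CausalDiagram

universe v u v₁ u₁ v₂ u₂ w w'

section Calculus

/-! ### Pairings and marginals in a Markov category -/

lemma tensorμ_tensorμ {C : Type u} [Category.{v} C] [MonoidalCategory C] [SymmetricCategory C]
    (X Y Z W : C) : tensorμ X Y Z W ≫ tensorμ X Z Y W = 𝟙 _ := by
  have : tensorμ X Z Y W = tensorδ X Y Z W := by
    simp only [tensorμ, tensorδ, SymmetricCategory.braiding_swap_eq_inv_braiding Y Z]
  rw [this, tensorμ_tensorδ]

lemma braiding_tensorμ {C : Type u} [Category.{v} C] [MonoidalCategory C] [SymmetricCategory C]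
    (X Y Z W : C) : tensorμ X Y Z W ≫ ((β_ X Z).hom ⊗ₘ (β_ Y W).hom) =
    (β_ (X ⊗ Y) (Z ⊗ W)).hom ≫ tensorμ Z W X Y := by
  have h : (β_ (X ⊗ Y) (Z ⊗ W)).hom = 𝟙 _ ⊗≫ X ◁ (β_ Y Z).hom ▷ W ⊗≫ ((β_ X Z).hom ▷ (Y ⊗ W) ≫
     (Z ⊗ X) ◁ (β_ Y W).hom) ⊗≫ Z ◁ (β_ X W).hom ▷ Y ⊗≫ 𝟙 _ := by
    rw [BraidedCategory.braiding_tensor_left_hom, BraidedCategory.braiding_tensor_right_hom,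
      BraidedCategory.braiding_tensor_right_hom, ← whisker_exchange]
    monoidal
  rw [h]
  have e : Z ◁ (β_ X W).hom ▷ Y ≫ Z ◁ (β_ W X).hom ▷ Y = 𝟙 _ := by
    rw [← MonoidalCategory.whiskerLeft_comp, ← comp_whiskerRight, SymmetricCategory.symmetry]; simp
  calc _ = 𝟙 _ ⊗≫ X ◁ (β_ Y Z).hom ▷ W ⊗≫ ((β_ X Z).hom ▷ (Y ⊗ W) ≫
     (Z ⊗ X) ◁ (β_ Y W).hom) ⊗≫ 𝟙 _ := by
        rw [MonoidalCategory.tensorHom_def, tensorμ]; monoidal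
    _ = 𝟙 _ ⊗≫ X ◁ (β_ Y Z).hom ▷ W ⊗≫ ((β_ X Z).hom ▷ (Y ⊗ W) ≫
     (Z ⊗ X) ◁ (β_ Y W).hom) ⊗≫ (Z ◁ (β_ X W).hom ▷ Y ≫ Z ◁ (β_ W X).hom ▷ Y) ⊗≫ 𝟙 _ := by
        rw [e]; monoidal
    _ = _ := by rw [tensorμ]; monoidal

lemma copy_copy_copy {C : Type u} [Category.{v} C] [MonoidalCategory C]
    (X : C) [ComonObj X] : Δ[X] ≫ (Δ[X] ⊗ₘ Δ[X]) =
      Δ[X] ≫ (X ◁ (Δ[X] ≫ (Δ[X] ▷ X))) ≫ X ◁ (α_ X X X).hom ≫ (α_ X X (X ⊗ X)).inv := by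
  have h1 := ComonObj.comul_assoc X
  have h2 : Δ[X] ≫ (Δ[X] ▷ X) = Δ[X] ≫ X ◁ Δ[X] ≫ (α_ X X X).inv := by simp
  rw [← MonoidalCategory.whiskerLeft_comp_assoc, Category.assoc, ← h1,
    MonoidalCategory.tensorHom_def, reassoc_of% h2]
  simp only [MonoidalCategory.whiskerLeft_comp, Category.assoc,
    MonoidalCategory.tensor_whiskerLeft, Iso.inv_hom_id_assoc]

variable {C : Type u} [Category.{v} C] [MonoidalCategory C] [MarkovCategory C]

/-- The pairing of `f` and `g`: copy the input, then run `f` and `g` on the two copies. -/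
def pair {Z X Y : C} (f : Z ⟶ X) (g : Z ⟶ Y) : Z ⟶ X ⊗ Y := Δ[Z] ≫ (f ⊗ₘ g)

/-- First marginal: discard the second factor. -/
def pfst (X Y : C) : X ⊗ Y ⟶ X := (X ◁ ε[Y]) ≫ (ρ_ X).hom

/-- Second marginal: discard the first factor. -/
def psnd (X Y : C) : X ⊗ Y ⟶ Y := (ε[X] ▷ Y) ≫ (λ_ Y).hom

lemma det_of_comul {X Y : C} (f : X ⟶ Y) (h : f ≫ Δ[Y] = Δ[X] ≫ (f ⊗ₘ f)) : Deterministic f where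
  hom_counit := MarkovCategory.discard_natural f
  hom_comul := h

instance det_id (X : C) : Deterministic (𝟙 X) := det_of_comul _ (by simp)

instance det_comp {X Y Z : C} (f : X ⟶ Y) (g : Y ⟶ Z) [Deterministic f] [Deterministic g] :
    Deterministic (f ≫ g) := det_of_comul _ (by
  rw [Category.assoc, IsComonHom.hom_comul, IsComonHom.hom_comul_assoc, tensorHom_comp_tensorHom])

instance det_tensor {X Y X' Y' : C} (f : X ⟶ Y) (g : X' ⟶ Y') [Deterministic f] [Deterministic g] :
    Deterministic (f ⊗ₘ g) := det_of_comul _ (by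
  rw [CopyDiscardCategory.copy_tensor, CopyDiscardCategory.copy_tensor, Category.assoc,
    ← tensorμ_natural, tensorHom_comp_tensorHom_assoc, tensorHom_comp_tensorHom_assoc,
    IsComonHom.hom_comul, IsComonHom.hom_comul])

instance det_whiskerLeft (X : C) {X' Y' : C} (g : X' ⟶ Y') [Deterministic g] :
    Deterministic (X ◁ g) := by
  rw [← id_tensorHom]; infer_instance

instance det_whiskerRight {X' Y' : C} (g : X' ⟶ Y') (X : C) [Deterministic g] :
    Deterministic (g ▷ X) := by
  rw [← tensorHom_id]; infer_instance

instance det_leftUnitor (X : C) : Deterministic (λ_ X).hom := det_of_comul _ (by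
  rw [CopyDiscardCategory.copy_tensor, CopyDiscardCategory.copy_unit, Category.assoc,
    leftUnitor_monoidal, reassoc_of% tensorμ_tensorμ]
  simp [MonoidalCategory.tensorHom_def'])

instance det_rightUnitor (X : C) : Deterministic (ρ_ X).hom := det_of_comul _ (by
  rw [CopyDiscardCategory.copy_tensor, CopyDiscardCategory.copy_unit, Category.assoc,
    rightUnitor_monoidal, reassoc_of% tensorμ_tensorμ, MonoidalCategory.tensorHom_def,
    Category.assoc, ← MonoidalCategory.whiskerLeft_comp_assoc]
  simp)

instance det_associator (X Y Z : C) : Deterministic (α_ X Y Z).hom := det_of_comul _ (by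
  have h := tensor_associativity X X Y Y Z Z
  have e1 : (CopyDiscardCategory.comonObj ((X ⊗ Y) ⊗ Z)).comul =
      ((Δ[X] ⊗ₘ Δ[Y]) ⊗ₘ Δ[Z]) ≫ (tensorμ X X Y Y ▷ (Z ⊗ Z)) ≫
      tensorμ (X ⊗ Y) (X ⊗ Y) Z Z := by
    rw [CopyDiscardCategory.copy_tensor, CopyDiscardCategory.copy_tensor, ← tensorHom_id,
      tensorHom_comp_tensorHom_assoc, Category.comp_id]
  have e2 : (CopyDiscardCategory.comonObj (X ⊗ Y ⊗ Z)).comul =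
      (Δ[X] ⊗ₘ Δ[Y] ⊗ₘ Δ[Z]) ≫ ((X ⊗ X) ◁ tensorμ Y Y Z Z) ≫
      tensorμ X X (Y ⊗ Z) (Y ⊗ Z) := by
    rw [CopyDiscardCategory.copy_tensor, CopyDiscardCategory.copy_tensor, ← id_tensorHom,
      tensorHom_comp_tensorHom_assoc, Category.comp_id]
  rw [e1, e2, Category.assoc, Category.assoc, h, associator_naturality_assoc])

instance det_braiding (X Y : C) : Deterministic (β_ X Y).hom := det_of_comul _ (by
  rw [CopyDiscardCategory.copy_tensor, CopyDiscardCategory.copy_tensor, Category.assoc,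
    braiding_tensorμ, BraidedCategory.braiding_naturality_assoc])

instance det_copy (X : C) : Deterministic Δ[X] := det_of_comul _ (by
  have e' := IsCommComonObj.comul_comm X
  rw [CopyDiscardCategory.copy_tensor, reassoc_of% copy_copy_copy X, copy_copy_copy X]
  simp only [tensorμ, Iso.inv_hom_id_assoc]
  simp only [← MonoidalCategory.whiskerLeft_comp_assoc, Category.assoc, Iso.hom_inv_id_assoc,
    ← MonoidalCategory.comp_whiskerRight_assoc, e'])

instance det_discard (X : C) : Deterministic ε[X] := det_of_comul _ (by
  rw [CopyDiscardCategory.copy_unit, MonoidalCategory.tensorHom_def,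
    ComonObj.counit_comul_assoc]; simp)

instance det_pair {Z X Y : C} (f : Z ⟶ X) (g : Z ⟶ Y) [Deterministic f] [Deterministic g] :
    Deterministic (pair f g) := by unfold pair; infer_instance

instance det_pfst (X Y : C) : Deterministic (pfst X Y) := by unfold pfst; infer_instance

instance det_psnd (X Y : C) : Deterministic (psnd X Y) := by unfold psnd; infer_instance

lemma pair_tensor {Z X Y X' Y' : C} (f : Z ⟶ X) (g : Z ⟶ Y) (a : X ⟶ X') (b : Y ⟶ Y') :
    pair f g ≫ (a ⊗ₘ b) = pair (f ≫ a) (g ≫ b) := by simp [pair]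

lemma pair_tensor_assoc {Z X Y X' Y' : C} (f : Z ⟶ X) (g : Z ⟶ Y) (a : X ⟶ X') (b : Y ⟶ Y') {V : C}
    (k : X' ⊗ Y' ⟶ V) :
    pair f g ≫ (a ⊗ₘ b) ≫ k =
      pair (f ≫ a) (g ≫ b) ≫ k :=
  by rw [reassoc_of% (pair_tensor f g a b)]

lemma comp_pair {W Z X Y : C} (h : W ⟶ Z) [Deterministic h] (f : Z ⟶ X) (g : Z ⟶ Y) :
    h ≫ pair f g = pair (h ≫ f) (h ≫ g) := by simp [pair]

lemma comp_pair_assoc {W Z X Y : C} (h : W ⟶ Z) [Deterministic h] (f : Z ⟶ X) (g : Z ⟶ Y) {V : C}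
    (k : X ⊗ Y ⟶ V) :
    h ≫ pair f g ≫ k =
      pair (h ≫ f) (h ≫ g) ≫ k :=
  by rw [reassoc_of% (comp_pair h f g)]

@[simp]
lemma tensor_pfst {X Y X' Y' : C} (f : X ⟶ X') (g : Y ⟶ Y') :
    (f ⊗ₘ g) ≫ pfst X' Y' = pfst X Y ≫ f := by
  rw [pfst, MonoidalCategory.tensorHom_def, Category.assoc, ← MonoidalCategory.whiskerLeft_comp_assoc,
    MarkovCategory.discard_natural, ← whisker_exchange_assoc, rightUnitor_naturality, pfst,
    Category.assoc]

@[simp]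
lemma tensor_pfst_assoc {X Y X' Y' : C} (f : X ⟶ X') (g : Y ⟶ Y') {V : C}
    (k : X' ⟶ V) :
    (f ⊗ₘ g) ≫ pfst X' Y' ≫ k =
      pfst X Y ≫ f ≫ k :=
  by rw [reassoc_of% (tensor_pfst f g)]

@[simp]
lemma tensor_psnd {X Y X' Y' : C} (f : X ⟶ X') (g : Y ⟶ Y') :
    (f ⊗ₘ g) ≫ psnd X' Y' = psnd X Y ≫ g := by
  rw [psnd, MonoidalCategory.tensorHom_def', Category.assoc, ← MonoidalCategory.comp_whiskerRight_assoc,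
    MarkovCategory.discard_natural, whisker_exchange_assoc, leftUnitor_naturality, psnd,
    Category.assoc]

@[simp]
lemma tensor_psnd_assoc {X Y X' Y' : C} (f : X ⟶ X') (g : Y ⟶ Y') {V : C}
    (k : Y' ⟶ V) :
    (f ⊗ₘ g) ≫ psnd X' Y' ≫ k =
      psnd X Y ≫ g ≫ k :=
  by rw [reassoc_of% (tensor_psnd f g)]

@[simp]
lemma copy_pfst (X : C) : Δ[X] ≫ pfst X X = 𝟙 X := by simp [pfst]

@[simp]
lemma copy_pfst_assoc (X : C) {V : C}
    (k : X ⟶ V) :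
    Δ[X] ≫ pfst X X ≫ k =
      k :=
  by rw [reassoc_of% (copy_pfst X)]

@[simp]
lemma copy_psnd (X : C) : Δ[X] ≫ psnd X X = 𝟙 X := by simp [psnd]

@[simp]
lemma copy_psnd_assoc (X : C) {V : C}
    (k : X ⟶ V) :
    Δ[X] ≫ psnd X X ≫ k =
      k :=
  by rw [reassoc_of% (copy_psnd X)]

@[simp]
lemma pair_fst {Z X Y : C} (f : Z ⟶ X) (g : Z ⟶ Y) : pair f g ≫ pfst X Y = f := by
  simp [pair]

@[simp]
lemma pair_fst_assoc {Z X Y : C} (f : Z ⟶ X) (g : Z ⟶ Y) {V : C}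
    (k : X ⟶ V) :
    pair f g ≫ pfst X Y ≫ k =
      f ≫ k :=
  by rw [reassoc_of% (pair_fst f g)]

@[simp]
lemma pair_snd {Z X Y : C} (f : Z ⟶ X) (g : Z ⟶ Y) : pair f g ≫ psnd X Y = g := by
  simp [pair]

@[simp]
lemma pair_snd_assoc {Z X Y : C} (f : Z ⟶ X) (g : Z ⟶ Y) {V : C}
    (k : Y ⟶ V) :
    pair f g ≫ psnd X Y ≫ k =
      g ≫ k :=
  by rw [reassoc_of% (pair_snd f g)]

@[simp]
lemma pair_pfst_psnd (X Y : C) : pair (pfst X Y) (psnd X Y) = 𝟙 (X ⊗ Y) := by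
  rw [pair, CopyDiscardCategory.copy_tensor, Category.assoc, pfst, psnd]
  rw [← tensorHom_comp_tensorHom, ← id_tensorHom, ← tensorHom_id, ← tensorμ_natural_assoc,
    tensorHom_comp_tensorHom_assoc, id_tensorHom, tensorHom_id, ComonObj.comul_counit,
    ComonObj.counit_comul, tensorμ]
  have hb : (β_ (𝟙_ C) (𝟙_ C)).hom = 𝟙 _ := by
    rw [braiding_tensorUnit_left, unitors_equal]; simp
  rw [hb]
  monoidal

lemma det_ext {Z X Y : C} (f g : Z ⟶ X ⊗ Y) [Deterministic f] [Deterministic g]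
    (h₁ : f ≫ pfst X Y = g ≫ pfst X Y) (h₂ : f ≫ psnd X Y = g ≫ psnd X Y) : f = g := by
  rw [← Category.comp_id f, ← Category.comp_id g, ← pair_pfst_psnd, comp_pair, comp_pair, h₁, h₂]


lemma tensor_eq_pair {X Y X' Y' : C} (f : X ⟶ X') (g : Y ⟶ Y') :
    f ⊗ₘ g = pair (pfst X Y ≫ f) (psnd X Y ≫ g) := by
  rw [← pair_tensor, pair_pfst_psnd, Category.id_comp]

@[simp]
lemma whiskerLeft_pfst (X : C) {Y Y' : C} (g : Y ⟶ Y') : (X ◁ g) ≫ pfst X Y' = pfst X Y := by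
  rw [← id_tensorHom, tensor_pfst, Category.comp_id]

@[simp]
lemma whiskerLeft_pfst_assoc (X : C) {Y Y' : C} (g : Y ⟶ Y') {V : C}
    (k : X ⟶ V) :
    (X ◁ g) ≫ pfst X Y' ≫ k =
      pfst X Y ≫ k :=
  by rw [reassoc_of% (whiskerLeft_pfst X g)]

@[simp]
lemma whiskerLeft_psnd (X : C) {Y Y' : C} (g : Y ⟶ Y') : (X ◁ g) ≫ psnd X Y' = psnd X Y ≫ g := by
  rw [← id_tensorHom, tensor_psnd]

@[simp]
lemma whiskerLeft_psnd_assoc (X : C) {Y Y' : C} (g : Y ⟶ Y') {V : C}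
    (k : Y' ⟶ V) :
    (X ◁ g) ≫ psnd X Y' ≫ k =
      psnd X Y ≫ g ≫ k :=
  by rw [reassoc_of% (whiskerLeft_psnd X g)]

@[simp]
lemma whiskerRight_pfst (X : C) {Y Y' : C} (g : Y ⟶ Y') : (g ▷ X) ≫ pfst Y' X = pfst Y X ≫ g := by
  rw [← tensorHom_id, tensor_pfst]

@[simp]
lemma whiskerRight_pfst_assoc (X : C) {Y Y' : C} (g : Y ⟶ Y') {V : C}
    (k : Y' ⟶ V) :
    (g ▷ X) ≫ pfst Y' X ≫ k =
      pfst Y X ≫ g ≫ k :=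
  by rw [reassoc_of% (whiskerRight_pfst X g)]

@[simp]
lemma whiskerRight_psnd (X : C) {Y Y' : C} (g : Y ⟶ Y') : (g ▷ X) ≫ psnd Y' X = psnd Y X := by
  rw [← tensorHom_id, tensor_psnd, Category.comp_id]

@[simp]
lemma whiskerRight_psnd_assoc (X : C) {Y Y' : C} (g : Y ⟶ Y') {V : C}
    (k : X ⟶ V) :
    (g ▷ X) ≫ psnd Y' X ≫ k =
      psnd Y X ≫ k :=
  by rw [reassoc_of% (whiskerRight_psnd X g)]

@[simp]
lemma braiding_pfst (X Y : C) : (β_ X Y).hom ≫ pfst Y X = psnd X Y := by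
  simp only [pfst, psnd]
  rw [← BraidedCategory.braiding_naturality_left_assoc, braiding_rightUnitor]

@[simp]
lemma braiding_pfst_assoc (X Y : C) {V : C}
    (k : Y ⟶ V) :
    (β_ X Y).hom ≫ pfst Y X ≫ k =
      psnd X Y ≫ k :=
  by rw [reassoc_of% (braiding_pfst X Y)]

@[simp]
lemma braiding_psnd (X Y : C) : (β_ X Y).hom ≫ psnd Y X = pfst X Y := by
  simp only [pfst, psnd]
  rw [← BraidedCategory.braiding_naturality_right_assoc, braiding_leftUnitor]

@[simp]
lemma braiding_psnd_assoc (X Y : C) {V : C}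
    (k : X ⟶ V) :
    (β_ X Y).hom ≫ psnd Y X ≫ k =
      pfst X Y ≫ k :=
  by rw [reassoc_of% (braiding_psnd X Y)]

lemma leftUnitor_eq (X : C) : (λ_ X).hom = psnd (𝟙_ C) X := by
  rw [psnd, CopyDiscardCategory.discard_unit]; simp

lemma rightUnitor_eq (X : C) : (ρ_ X).hom = pfst X (𝟙_ C) := by
  rw [pfst, CopyDiscardCategory.discard_unit]; simp

@[simp]
lemma associator_pfst (X Y Z : C) :
    (α_ X Y Z).hom ≫ pfst X (Y ⊗ Z) = pfst (X ⊗ Y) Z ≫ pfst X Y := by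
  have e : (CopyDiscardCategory.comonObj (Y ⊗ Z)).counit = Y ◁ ε[Z] ≫ (ρ_ Y).hom ≫ ε[Y] :=
    (MarkovCategory.eq_discard _ _).symm
  simp only [pfst, e]
  monoidal

@[simp]
lemma associator_pfst_assoc (X Y Z : C) {V : C}
    (k : X ⟶ V) :
    (α_ X Y Z).hom ≫ pfst X (Y ⊗ Z) ≫ k =
      pfst (X ⊗ Y) Z ≫ pfst X Y ≫ k :=
  by rw [reassoc_of% (associator_pfst X Y Z)]

@[simp]
lemma associator_psnd_psnd (X Y Z : C) :
    (α_ X Y Z).hom ≫ psnd X (Y ⊗ Z) ≫ psnd Y Z = psnd (X ⊗ Y) Z := by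
  have e : (CopyDiscardCategory.comonObj (X ⊗ Y)).counit = ε[X] ▷ Y ≫ (λ_ Y).hom ≫ ε[Y] :=
    (MarkovCategory.eq_discard _ _).symm
  simp only [psnd, e]
  monoidal

@[simp]
lemma associator_psnd_psnd_assoc (X Y Z : C) {V : C}
    (k : Z ⟶ V) :
    (α_ X Y Z).hom ≫ psnd X (Y ⊗ Z) ≫ psnd Y Z ≫ k =
      psnd (X ⊗ Y) Z ≫ k :=
  by rw [reassoc_of% (associator_psnd_psnd X Y Z)]

@[simp]
lemma associator_psnd_pfst (X Y Z : C) :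
    (α_ X Y Z).hom ≫ psnd X (Y ⊗ Z) ≫ pfst Y Z = pfst (X ⊗ Y) Z ≫ psnd X Y := by
  simp only [psnd, pfst]
  rw [Category.assoc, Category.assoc, ← rightUnitor_naturality_assoc, whisker_exchange_assoc]
  monoidal

@[simp]
lemma associator_psnd_pfst_assoc (X Y Z : C) {V : C}
    (k : Y ⟶ V) :
    (α_ X Y Z).hom ≫ psnd X (Y ⊗ Z) ≫ pfst Y Z ≫ k =
      pfst (X ⊗ Y) Z ≫ psnd X Y ≫ k :=
  by rw [reassoc_of% (associator_psnd_pfst X Y Z)]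

lemma associator_psnd (X Y Z : C) :
    (α_ X Y Z).hom ≫ psnd X (Y ⊗ Z) = pair (pfst (X ⊗ Y) Z ≫ psnd X Y) (psnd (X ⊗ Y) Z) :=
  det_ext _ _ (by simp) (by simp)

/-- A tensor of pairings is the pairing of tensors, up to exchanging the middle factors. -/
lemma pair_tensor_pair {Z W X Y X' Y' : C} (f : Z ⟶ X) (g : Z ⟶ Y) (f' : W ⟶ X') (g' : W ⟶ Y') :
    (pair f g ⊗ₘ pair f' g') ≫ tensorμ X Y X' Y' = pair (f ⊗ₘ f') (g ⊗ₘ g') := by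
  rw [pair, pair, pair, CopyDiscardCategory.copy_tensor, Category.assoc, ← tensorμ_natural,
    tensorHom_comp_tensorHom_assoc]

@[simp]
lemma associator_inv_psnd (X Y Z : C) :
    (α_ X Y Z).inv ≫ psnd (X ⊗ Y) Z = psnd X (Y ⊗ Z) ≫ psnd Y Z := by
  rw [Iso.inv_comp_eq]; simp

@[simp]
lemma associator_inv_psnd_assoc (X Y Z : C) {V : C}
    (k : Z ⟶ V) :
    (α_ X Y Z).inv ≫ psnd (X ⊗ Y) Z ≫ k =
      psnd X (Y ⊗ Z) ≫ psnd Y Z ≫ k :=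
  by rw [reassoc_of% (associator_inv_psnd X Y Z)]

@[simp]
lemma associator_inv_pfst_pfst (X Y Z : C) :
    (α_ X Y Z).inv ≫ pfst (X ⊗ Y) Z ≫ pfst X Y = pfst X (Y ⊗ Z) := by
  rw [Iso.inv_comp_eq]; simp

@[simp]
lemma associator_inv_pfst_pfst_assoc (X Y Z : C) {V : C}
    (k : X ⟶ V) :
    (α_ X Y Z).inv ≫ pfst (X ⊗ Y) Z ≫ pfst X Y ≫ k =
      pfst X (Y ⊗ Z) ≫ k :=
  by rw [reassoc_of% (associator_inv_pfst_pfst X Y Z)]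

@[simp]
lemma associator_inv_pfst_psnd (X Y Z : C) :
    (α_ X Y Z).inv ≫ pfst (X ⊗ Y) Z ≫ psnd X Y = psnd X (Y ⊗ Z) ≫ pfst Y Z := by
  rw [Iso.inv_comp_eq]; simp

@[simp]
lemma associator_inv_pfst_psnd_assoc (X Y Z : C) {V : C}
    (k : Y ⟶ V) :
    (α_ X Y Z).inv ≫ pfst (X ⊗ Y) Z ≫ psnd X Y ≫ k =
      psnd X (Y ⊗ Z) ≫ pfst Y Z ≫ k :=
  by rw [reassoc_of% (associator_inv_pfst_psnd X Y Z)]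

@[simp]
lemma tensorμ_pfst_pfst (X Y Z W : C) : tensorμ X Y Z W ≫ pfst _ _ ≫ pfst _ _ =
    pfst _ _ ≫ pfst _ _ := by
  simp [tensorμ]

@[simp]
lemma tensorμ_pfst_pfst_assoc (X Y Z W : C) {V : C}
    (k : X ⟶ V) :
    tensorμ X Y Z W ≫ pfst _ _ ≫ pfst _ _ ≫ k =
      pfst _ _ ≫ pfst _ _ ≫ k :=
  by rw [reassoc_of% (tensorμ_pfst_pfst X Y Z W)]

@[simp]
lemma tensorμ_pfst_psnd (X Y Z W : C) : tensorμ X Y Z W ≫ pfst _ _ ≫ psnd _ _ =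
    psnd _ _ ≫ pfst _ _ := by
  simp [tensorμ]

@[simp]
lemma tensorμ_pfst_psnd_assoc (X Y Z W : C) {V : C}
    (k : Z ⟶ V) :
    tensorμ X Y Z W ≫ pfst _ _ ≫ psnd _ _ ≫ k =
      psnd _ _ ≫ pfst _ _ ≫ k :=
  by rw [reassoc_of% (tensorμ_pfst_psnd X Y Z W)]

@[simp]
lemma tensorμ_psnd_pfst (X Y Z W : C) : tensorμ X Y Z W ≫ psnd _ _ ≫ pfst _ _ =
    pfst _ _ ≫ psnd _ _ := by
  simp [tensorμ]

@[simp]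
lemma tensorμ_psnd_pfst_assoc (X Y Z W : C) {V : C}
    (k : Y ⟶ V) :
    tensorμ X Y Z W ≫ psnd _ _ ≫ pfst _ _ ≫ k =
      pfst _ _ ≫ psnd _ _ ≫ k :=
  by rw [reassoc_of% (tensorμ_psnd_pfst X Y Z W)]

@[simp]
lemma tensorμ_psnd_psnd (X Y Z W : C) : tensorμ X Y Z W ≫ psnd _ _ ≫ psnd _ _ =
    psnd _ _ ≫ psnd _ _ := by
  simp [tensorμ]

@[simp]
lemma tensorμ_psnd_psnd_assoc (X Y Z W : C) {V : C}
    (k : W ⟶ V) :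
    tensorμ X Y Z W ≫ psnd _ _ ≫ psnd _ _ ≫ k =
      psnd _ _ ≫ psnd _ _ ≫ k :=
  by rw [reassoc_of% (tensorμ_psnd_psnd X Y Z W)]

instance det_tensorμ (X Y Z W : C) : Deterministic (tensorμ X Y Z W) := by
  unfold tensorμ; infer_instance

lemma pair_assoc {Z A B D : C} (f : Z ⟶ A) (g : Z ⟶ B) (h : Z ⟶ D) :
    pair (pair f g) h ≫ (α_ A B D).hom = pair f (pair g h) := by
  have e1 : pair (pair f g) h = (Δ[Z] ≫ (Δ[Z] ▷ Z)) ≫ ((f ⊗ₘ g) ⊗ₘ h) := by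
    simp only [pair, ← tensorHom_id, Category.assoc, tensorHom_comp_tensorHom, Category.id_comp]
  have e2 : pair f (pair g h) = (Δ[Z] ≫ (Z ◁ Δ[Z])) ≫ (f ⊗ₘ (g ⊗ₘ h)) := by
    simp only [pair, ← id_tensorHom, Category.assoc, tensorHom_comp_tensorHom, Category.id_comp]
  rw [e1, e2, Category.assoc, associator_naturality, ComonObj.comul_assoc]
  simp only [Category.assoc]

lemma pair_braiding {Z A B : C} (f : Z ⟶ A) (g : Z ⟶ B) :
    pair f g ≫ (β_ A B).hom = pair g f := by
  rw [pair, Category.assoc, BraidedCategory.braiding_naturality, IsCommComonObj.comul_comm_assoc,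
    pair]

/-- Remembering the input before or after sampling makes no difference. -/
lemma pair_comp_id {Z A B : C} (g : Z ⟶ A) (h : A ⊗ Z ⟶ B) :
    pair (pair g (𝟙 Z) ≫ h) (𝟙 Z) = pair g (𝟙 Z) ≫ pair h (psnd A Z) := by
  have e : pair (𝟙 (A ⊗ Z)) (psnd A Z) = (𝟙 A ⊗ₘ Δ[Z]) ≫ (α_ A Z Z).inv := by
    apply det_ext
    · apply det_ext <;> simp
    · simp
  have e2 : pair (pair g (𝟙 Z)) (𝟙 Z) = pair g (𝟙 Z) ≫ pair (𝟙 (A ⊗ Z)) (psnd A Z) := by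
    rw [e, pair_tensor_assoc, Iso.eq_comp_inv, pair_assoc]
    simp [pair]
  have e3 : pair (pair g (𝟙 Z) ≫ h) (𝟙 Z) = pair (pair g (𝟙 Z)) (𝟙 Z) ≫ (h ⊗ₘ 𝟙 Z) := by
    rw [pair_tensor, Category.comp_id]
  rw [e3, e2, Category.assoc, pair_tensor, Category.id_comp, Category.comp_id]

lemma pair_pair_id {Z A B D : C} (p : Z ⟶ D) (f : Z ⟶ A) (h : A ⊗ Z ⟶ B) :
    pair p (pair f (𝟙 Z) ≫ h) = pair f (𝟙 Z) ≫ pair (psnd A Z ≫ p) h := by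
  have e : pair (pair f (𝟙 Z) ≫ h) p = pair (pair f (𝟙 Z) ≫ h) (𝟙 Z) ≫ (𝟙 _ ⊗ₘ p) := by
    rw [pair_tensor, Category.comp_id, Category.id_comp]
  rw [← pair_braiding, e, pair_comp_id, Category.assoc, Category.assoc, pair_tensor_assoc,
    pair_braiding, Category.comp_id]

lemma pair_pair_id' {Z A B D : C} (p : Z ⟶ D) (f : Z ⟶ A) (h : A ⊗ Z ⟶ B) :
    pair (pair f (𝟙 Z) ≫ h) p = pair f (𝟙 Z) ≫ pair h (psnd A Z ≫ p) := by
  rw [← pair_braiding, pair_pair_id, Category.assoc, pair_braiding]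

end Calculus

/-! ### Joint Markov kernels -/

/-- A joint Markov kernel from `Z` to `X`: a residual object `R`, a deterministic mechanism
`R ⊗ Z ⟶ X` and a noise kernel `Z ⟶ R`. -/
structure JointKernel {C : Type u} [Category.{v} C] [MonoidalCategory C] [MarkovCategory C]
    (Z X : C) where
  /-- the residual object -/
  res : C
  /-- the mechanism -/
  mech : res ⊗ Z ⟶ X
  /-- the noise -/
  noise : Z ⟶ res
  [det : Deterministic mech]

attribute [instance] JointKernel.det

namespace JointKernel

variable {C : Type u} [Category.{v} C] [MonoidalCategory C] [MarkovCategory C]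

/-- A deterministic map of residuals which carries one joint kernel to another. -/
def Reparam {Z X : C} (a b : JointKernel Z X) : Prop :=
  ∃ r : a.res ⟶ b.res, Deterministic r ∧ a.noise ≫ r = b.noise ∧ (r ▷ Z) ≫ b.mech = a.mech

/-- A deterministic morphism as a joint kernel without noise. -/
def pure {Z X : C} (h : Z ⟶ X) [Deterministic h] : JointKernel Z X where
  res := 𝟙_ C
  mech := psnd (𝟙_ C) Z ≫ h
  noise := ε[Z]

/-- Composition: the mechanism is `(r, s, z) ↦ b.mech (s, a.mech (r, z))`; the noise samples `r`
from `a.noise z` and then `s` from `b.noise (a.mech (r, z))`. -/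
def comp {Z X Y : C} (a : JointKernel Z X) (b : JointKernel X Y) : JointKernel Z Y where
  res := a.res ⊗ b.res
  mech := pair (pfst (a.res ⊗ b.res) Z ≫ psnd a.res b.res)
    (pair (pfst (a.res ⊗ b.res) Z ≫ pfst a.res b.res) (psnd (a.res ⊗ b.res) Z) ≫ a.mech) ≫ b.mech
  noise := pair a.noise (𝟙 Z) ≫ pair (pfst a.res Z) (a.mech ≫ b.noise)

/-- Monoidal product: pair the mechanisms and the noises. -/
def tensor {Z X Z' X' : C} (a : JointKernel Z X) (b : JointKernel Z' X') :
    JointKernel (Z ⊗ Z') (X ⊗ X') where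
  res := a.res ⊗ b.res
  mech := tensorμ a.res b.res Z Z' ≫ (a.mech ⊗ₘ b.mech)
  noise := a.noise ⊗ₘ b.noise

lemma Reparam.comp_left {Z X Y : C} {a a' : JointKernel Z X} (h : Reparam a a')
    (b : JointKernel X Y) : Reparam (a.comp b) (a'.comp b) := by
  obtain ⟨r, hr, hn, hm⟩ := h
  refine ⟨r ▷ b.res, det_whiskerRight _ _, ?_, ?_⟩
  · simp only [comp, ← hn, ← hm, Category.assoc]
    have : pair (a.noise ≫ r) (𝟙 Z) = pair a.noise (𝟙 Z) ≫ (r ▷ Z) := by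
      rw [← tensorHom_id, pair_tensor, Category.comp_id]
    rw [this, Category.assoc, comp_pair, ← tensorHom_id r b.res, pair_tensor]
    simp
  · simp only [comp, ← hm, comp_pair_assoc]
    rw [← tensorHom_id r Z, pair_tensor_assoc]
    simp

lemma Reparam.comp_right {Z X Y : C} (a : JointKernel Z X) {b b' : JointKernel X Y}
    (h : Reparam b b') : Reparam (a.comp b) (a.comp b') := by
  obtain ⟨r, hr, hn, hm⟩ := h
  refine ⟨a.res ◁ r, det_whiskerLeft _ _, ?_, ?_⟩
  · simp only [comp, ← hn, Category.assoc]
    rw [← id_tensorHom, pair_tensor]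
    simp
  · simp only [comp, ← hm, comp_pair_assoc]
    rw [← tensorHom_id r X, pair_tensor_assoc]
    simp

lemma Reparam.tensor_left {Z X Z' X' : C} {a a' : JointKernel Z X} (h : Reparam a a')
    (b : JointKernel Z' X') : Reparam (a.tensor b) (a'.tensor b) := by
  obtain ⟨r, hr, hn, hm⟩ := h
  refine ⟨r ▷ b.res, det_whiskerRight _ _, ?_, ?_⟩
  · simp [tensor, ← hn, ← tensorHom_id]
  · simp only [tensor, ← hm]
    rw [← tensorHom_id r b.res, tensorμ_natural_left_assoc, tensorHom_comp_tensorHom,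
      id_whiskerRight, Category.id_comp]

lemma Reparam.tensor_right {Z X Z' X' : C} (a : JointKernel Z X) {b b' : JointKernel Z' X'}
    (h : Reparam b b') : Reparam (a.tensor b) (a.tensor b') := by
  obtain ⟨r, hr, hn, hm⟩ := h
  refine ⟨a.res ◁ r, det_whiskerLeft _ _, ?_, ?_⟩
  · simp [tensor, ← hn, ← id_tensorHom]
  · simp only [tensor, ← hm]
    rw [← id_tensorHom a.res r, tensorμ_natural_left_assoc, tensorHom_comp_tensorHom,
      id_whiskerRight, Category.id_comp]

lemma reparam_comp_pure {Z X Y : C} (a : JointKernel Z X) (h : X ⟶ Y) [Deterministic h] :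
    Reparam (a.comp (pure h)) ⟨a.res, a.mech ≫ h, a.noise⟩ := by
  refine ⟨pfst _ _, det_pfst _ _, ?_, ?_⟩
  · simp [comp, pure]
  · simp only [comp, pure, pair_snd_assoc, Category.assoc]
    rw [← Category.assoc, ← Category.assoc (pair _ _)]
    congr 2
    apply det_ext <;> simp

lemma reparam_pure_comp {Z X Y : C} (h : Z ⟶ X) [Deterministic h] (a : JointKernel X Y) :
    Reparam ((pure h).comp a) ⟨a.res, (a.res ◁ h) ≫ a.mech, h ≫ a.noise⟩ := by
  refine ⟨psnd _ _, det_psnd _ _, ?_, ?_⟩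
  · simp [comp, pure]
  · simp only [comp, pure, pair_snd_assoc]
    rw [← Category.assoc]
    congr 1
    apply det_ext <;> simp

lemma reparam_comp_assoc {W Z X Y : C} (a : JointKernel W Z) (b : JointKernel Z X)
    (c : JointKernel X Y) : Reparam ((a.comp b).comp c) (a.comp (b.comp c)) := by
  refine ⟨(α_ _ _ _).hom, det_associator _ _ _, ?_, ?_⟩
  · simp only [comp]
    rw [pair_comp_id, Category.assoc, Category.assoc]
    congr 1
    generalize hφ : a.mech ≫ b.noise = φ
    have e1 : pair (pair (pfst a.res W) φ) (psnd a.res W) = pair φ (𝟙 _) ≫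
        pair (pair (psnd _ _ ≫ pfst a.res W) (pfst _ _)) (psnd _ _ ≫ psnd a.res W) := by
      rw [← pair_pair_id', ← pair_pair_id, pair_fst]
    have e2 : a.mech ≫ pair b.noise (𝟙 Z) ≫ pair (pfst b.res Z) (b.mech ≫ c.noise) =
        pair φ (𝟙 _) ≫ (𝟙 _ ⊗ₘ a.mech) ≫ pair (pfst b.res Z) (b.mech ≫ c.noise) := by
      rw [comp_pair_assoc, pair_tensor_assoc, hφ]; simp
    rw [e1, e2, pair_pair_id, Category.assoc]
    congr 1
    rw [comp_pair_assoc, pair_fst, pair_assoc, comp_pair, tensor_pfst, Category.comp_id]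
    congr 2
    rw [← Category.assoc, ← Category.assoc, ← Category.assoc]
    congr 2
    rw [comp_pair]
    apply det_ext
    · simp
    · simp only [pair_snd, tensor_psnd, comp_pair_assoc]
      simp only [← Category.assoc]
      congr 1
      apply det_ext <;> simp
  · simp only [comp, comp_pair_assoc]
    congr 1
    apply det_ext <;> simp

lemma reparam_tensor_comp {X Y Z X' Y' Z' : C} (a : JointKernel X Y) (a' : JointKernel X' Y')
    (b : JointKernel Y Z) (b' : JointKernel Y' Z') :
    Reparam ((a.comp b).tensor (a'.comp b')) ((a.tensor a').comp (b.tensor b')) := by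
  refine ⟨tensorμ _ _ _ _, det_tensorμ _ _ _ _, ?_, ?_⟩
  · simp only [comp, tensor]
    have e : pair (a.noise ⊗ₘ a'.noise) (𝟙 (X ⊗ X')) =
        (pair a.noise (𝟙 X) ⊗ₘ pair a'.noise (𝟙 X')) ≫ tensorμ _ _ _ _ := by
      rw [pair_tensor_pair, id_tensorHom_id]
    have e2 : tensorμ a.res X a'.res X' ≫ pfst (a.res ⊗ a'.res) (X ⊗ X') =
        (pfst _ _ ⊗ₘ pfst _ _) := by
      apply det_ext <;> simp
    rw [e, ← tensorHom_comp_tensorHom, Category.assoc, pair_tensor_pair, Category.assoc,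
      comp_pair (tensorμ _ _ _ _), e2, Category.assoc, reassoc_of% tensorμ_tensorμ, tensorHom_comp_tensorHom]
  · simp only [comp, tensor]
    rw [comp_pair_assoc, ← tensorHom_comp_tensorHom]
    simp only [← Category.assoc]
    congr 1
    apply det_ext <;> apply det_ext <;> simp [-whiskerRight_tensor] <;>
      simp only [← Category.assoc] <;> congr 1 <;> apply det_ext <;> simp [-whiskerRight_tensor]

lemma reparam_tensor_associator {X Y Z X' Y' Z' : C} (a : JointKernel X X') (b : JointKernel Y Y')
    (c : JointKernel Z Z') : Reparam
      ⟨_, ((a.tensor b).tensor c).mech ≫ (α_ X' Y' Z').hom, ((a.tensor b).tensor c).noise⟩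
      ⟨_, (_ ◁ (α_ X Y Z).hom) ≫ (a.tensor (b.tensor c)).mech,
        (α_ X Y Z).hom ≫ (a.tensor (b.tensor c)).noise⟩ := by
  refine ⟨(α_ _ _ _).hom, det_associator _ _ _, ?_, ?_⟩
  · simp [tensor]
  · simp only [tensor]
    apply det_ext
    · simp [-whiskerRight_tensor, -tensor_whiskerLeft]
      simp only [← Category.assoc]
      congr 1
      apply det_ext <;> simp [-whiskerRight_tensor, -tensor_whiskerLeft]
    · apply det_ext <;> simp [-whiskerRight_tensor, -tensor_whiskerLeft] <;>
        simp only [← Category.assoc] <;> congr 1 <;> apply det_ext <;>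
        simp [-whiskerRight_tensor, -tensor_whiskerLeft]

lemma reparam_unit_tensor {X X' : C} (a : JointKernel X X') : Reparam
      ⟨_, ((pure (𝟙 (𝟙_ C))).tensor a).mech ≫ (λ_ X').hom, ((pure (𝟙 (𝟙_ C))).tensor a).noise⟩
      ⟨_, (_ ◁ (λ_ X).hom) ≫ a.mech, (λ_ X).hom ≫ a.noise⟩ := by
  refine ⟨(λ_ _).hom, det_leftUnitor _, ?_, ?_⟩
  · simp [tensor, pure, leftUnitor_eq]
  · simp only [tensor, pure, leftUnitor_eq, Category.assoc, tensor_psnd]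
    simp only [← Category.assoc]
    congr 1
    apply det_ext <;>
      simp [-whiskerRight_tensor, -tensor_whiskerLeft, -id_whiskerLeft, -whiskerRight_id]

lemma reparam_tensor_unit {X X' : C} (a : JointKernel X X') : Reparam
      ⟨_, (a.tensor (pure (𝟙 (𝟙_ C)))).mech ≫ (ρ_ X').hom, (a.tensor (pure (𝟙 (𝟙_ C)))).noise⟩
      ⟨_, (_ ◁ (ρ_ X).hom) ≫ a.mech, (ρ_ X).hom ≫ a.noise⟩ := by
  refine ⟨(ρ_ _).hom, det_rightUnitor _, ?_, ?_⟩
  · simp [tensor, pure, rightUnitor_eq]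
  · simp only [tensor, pure, rightUnitor_eq, Category.assoc, tensor_pfst]
    simp only [← Category.assoc]
    congr 1
    apply det_ext <;>
      simp [-whiskerRight_tensor, -tensor_whiskerLeft, -id_whiskerLeft, -whiskerRight_id]

lemma reparam_tensor_braiding {X X' Y Y' : C} (a : JointKernel X X') (b : JointKernel Y Y') :
    Reparam
      ⟨_, (a.tensor b).mech ≫ (β_ X' Y').hom, (a.tensor b).noise⟩
      ⟨_, (_ ◁ (β_ X Y).hom) ≫ (b.tensor a).mech, (β_ X Y).hom ≫ (b.tensor a).noise⟩ := by
  refine ⟨(β_ _ _).hom, det_braiding _ _, ?_, ?_⟩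
  · simp [tensor]
  · simp only [tensor]
    apply det_ext <;> simp [-whiskerRight_tensor, -tensor_whiskerLeft] <;>
        simp only [← Category.assoc] <;> congr 1 <;> apply det_ext <;>
        simp [-whiskerRight_tensor, -tensor_whiskerLeft]

lemma reparam_discard {X Y : C} (a : JointKernel X Y) :
    Reparam ⟨a.res, a.mech ≫ ε[Y], a.noise⟩ (pure ε[X]) :=
  ⟨ε[a.res], det_discard _, by simp [pure],
    (MarkovCategory.eq_discard _ _).trans (MarkovCategory.eq_discard _ _).symm⟩

lemma reparam_pure_tensor_pure {X Y X' Y' : C} (h : X ⟶ Y) (h' : X' ⟶ Y') [Deterministic h]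
    [Deterministic h'] : Reparam ((pure h).tensor (pure h')) (pure (h ⊗ₘ h')) := by
  refine ⟨(λ_ _).hom, det_leftUnitor _, ?_, ?_⟩
  · exact (MarkovCategory.eq_discard _ _).trans (MarkovCategory.eq_discard _ _).symm
  · simp only [tensor, pure]
    rw [leftUnitor_eq]
    apply det_ext <;>
      simp [-whiskerRight_tensor, -tensor_whiskerLeft, -id_whiskerLeft, -whiskerRight_id]

end JointKernel

/-- The category of joint Markov kernels in `C`: it has the objects of `C`. (A separate type is
needed because the morphisms differ.) -/
structure Joint (C : Type u) where
  /-- the underlying object -/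
  obj : C

namespace Joint

variable {C : Type u} [Category.{v} C] [MonoidalCategory C] [MarkovCategory C]

open JointKernel

/-- Morphisms of `Joint C` are joint Markov kernels, identified along deterministic maps of
residuals. Without this identification the category laws would fail: for instance a kernel followed
by a discard has residual object `R ⊗ 𝟙_ C`, while the discard has residual object `𝟙_ C`. -/
instance : CategoryStruct.{max u v} (Joint C) where
  Hom X Y := Quot (Reparam (Z := X.obj) (X := Y.obj))
  id X := Quot.mk _ (pure (𝟙 X.obj))
  comp := Quot.map₂ comp (fun a _ _ h => h.comp_right a) (fun _ _ b h => h.comp_left b)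

/-- The morphism of `Joint C` given by a joint Markov kernel. -/
def ofKernel {X Y : Joint C} (a : JointKernel X.obj Y.obj) : X ⟶ Y := Quot.mk _ a

lemma ofKernel_eq {X Y : Joint C} {a b : JointKernel X.obj Y.obj} (h : Reparam a b) :
    (ofKernel a : X ⟶ Y) = ofKernel b := Quot.sound h

lemma ofKernel_surj {X Y : Joint C} (f : X ⟶ Y) : ∃ a, f = ofKernel a := by
  obtain ⟨a, rfl⟩ := Quot.exists_rep f
  exact ⟨a, rfl⟩

/-- A deterministic morphism of `C` as a morphism of `Joint C`. -/
def ofDet {X Y : Joint C} (h : X.obj ⟶ Y.obj) [Deterministic h] : X ⟶ Y := ofKernel (pure h)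

lemma ofKernel_comp {X Y Z : Joint C} (a : JointKernel X.obj Y.obj) (b : JointKernel Y.obj Z.obj) :
    (ofKernel a : X ⟶ Y) ≫ (ofKernel b : Y ⟶ Z) = ofKernel (a.comp b) := rfl

lemma ofKernel_comp_ofDet {X Y Z : Joint C} (a : JointKernel X.obj Y.obj) (h : Y.obj ⟶ Z.obj)
    [Deterministic h] : (ofKernel a : X ⟶ Y) ≫ (ofDet h : Y ⟶ Z) = ofKernel ⟨a.res, a.mech ≫ h, a.noise⟩ :=
  ofKernel_eq (reparam_comp_pure a h)

lemma ofDet_comp_ofKernel {X Y Z : Joint C} (h : X.obj ⟶ Y.obj) [Deterministic h]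
    (a : JointKernel Y.obj Z.obj) : (ofDet h : X ⟶ Y) ≫ (ofKernel a : Y ⟶ Z) =
      ofKernel ⟨a.res, (a.res ◁ h) ≫ a.mech, h ≫ a.noise⟩ :=
  ofKernel_eq (reparam_pure_comp h a)

@[simp]
lemma ofDet_comp_ofDet {X Y Z : Joint C} (h : X.obj ⟶ Y.obj) [Deterministic h]
    (h' : Y.obj ⟶ Z.obj) [Deterministic h'] :
    (ofDet h : X ⟶ Y) ≫ (ofDet h' : Y ⟶ Z) = ofDet (h ≫ h') := by
  rw [ofDet, ofKernel_comp_ofDet]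
  simp [ofDet, JointKernel.pure]

instance : Category.{max u v} (Joint C) where
  id_comp f := by
    obtain ⟨a, rfl⟩ := ofKernel_surj f
    exact (ofDet_comp_ofKernel (𝟙 _) a).trans (by simp)
  comp_id f := by
    obtain ⟨a, rfl⟩ := ofKernel_surj f
    exact (ofKernel_comp_ofDet a (𝟙 _)).trans (by simp)
  assoc f g h := by
    obtain ⟨a, rfl⟩ := ofKernel_surj f
    obtain ⟨b, rfl⟩ := ofKernel_surj g
    obtain ⟨c, rfl⟩ := ofKernel_surj h
    exact ofKernel_eq (reparam_comp_assoc a b c)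

lemma ofDet_congr {X Y : Joint C} {h h' : X.obj ⟶ Y.obj} [Deterministic h] [Deterministic h']
    (e : h = h') : (ofDet h : X ⟶ Y) = ofDet h' := by
  subst e; rfl

lemma id_eq (X : Joint C) : 𝟙 X = ofDet (𝟙 X.obj) := rfl

/-- A deterministic isomorphism of `C` as an isomorphism of `Joint C`. -/
def isoOfDet {X Y : Joint C} (e : X.obj ≅ Y.obj) [Deterministic e.hom] : X ≅ Y where
  hom := ofDet e.hom
  inv := ofDet e.inv
  hom_inv_id := by simp [id_eq]
  inv_hom_id := by simp [id_eq]

/-- The monoidal product of morphisms of `Joint C`. -/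
def tensorMap {X Y X' Y' : Joint C} (f : X ⟶ Y) (g : X' ⟶ Y') :
    (⟨X.obj ⊗ X'.obj⟩ : Joint C) ⟶ ⟨Y.obj ⊗ Y'.obj⟩ :=
  Quot.map₂ tensor (fun a _ _ h => h.tensor_right a) (fun _ _ b h => h.tensor_left b) f g

instance : MonoidalCategoryStruct (Joint C) where
  tensorObj X Y := ⟨X.obj ⊗ Y.obj⟩
  tensorUnit := ⟨𝟙_ C⟩
  tensorHom f g := tensorMap f g
  whiskerLeft X _ _ f := tensorMap (𝟙 X) f
  whiskerRight f Y := tensorMap f (𝟙 Y)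
  associator X Y Z := isoOfDet (α_ X.obj Y.obj Z.obj)
  leftUnitor X := isoOfDet (λ_ X.obj)
  rightUnitor X := isoOfDet (ρ_ X.obj)

lemma ofKernel_tensor {X Y X' Y' : Joint C} (a : JointKernel X.obj Y.obj) (b : JointKernel X'.obj Y'.obj) :
    (ofKernel a : X ⟶ Y) ⊗ₘ (ofKernel b : X' ⟶ Y') = ofKernel (a.tensor b) := rfl

@[simp]
lemma ofDet_tensor {X Y X' Y' : Joint C} (h : X.obj ⟶ Y.obj) [Deterministic h]
    (h' : X'.obj ⟶ Y'.obj) [Deterministic h'] :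
    (ofDet h : X ⟶ Y) ⊗ₘ (ofDet h' : X' ⟶ Y') = ofDet (X := X ⊗ X') (Y := Y ⊗ Y') (h ⊗ₘ h') :=
  ofKernel_eq (reparam_pure_tensor_pure h h')

lemma id_tensorMap (X Y : Joint C) :
    (𝟙 X ⊗ₘ 𝟙 Y) = 𝟙 (X ⊗ Y) := by
  rw [id_eq, id_eq, ofDet_tensor]
  exact ofDet_congr (id_tensorHom_id _ _)

instance : MonoidalCategory (Joint C) := .ofTensorHom
  (id_tensorHom_id := id_tensorMap)
  (id_tensorHom := fun _ _ _ _ => rfl)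
  (tensorHom_id := fun _ _ => rfl)
  (tensorHom_comp_tensorHom := fun f f' g g' => by
    obtain ⟨a, rfl⟩ := ofKernel_surj f
    obtain ⟨a', rfl⟩ := ofKernel_surj f'
    obtain ⟨b, rfl⟩ := ofKernel_surj g
    obtain ⟨b', rfl⟩ := ofKernel_surj g'
    exact (ofKernel_eq (reparam_tensor_comp a a' b b')).symm)
  (associator_naturality := fun f g h => by
    obtain ⟨a, rfl⟩ := ofKernel_surj f
    obtain ⟨b, rfl⟩ := ofKernel_surj g
    obtain ⟨c, rfl⟩ := ofKernel_surj h
    exact (ofKernel_comp_ofDet _ _).trans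
      ((ofKernel_eq (reparam_tensor_associator a b c)).trans (ofDet_comp_ofKernel _ _).symm))
  (leftUnitor_naturality := fun f => by
    obtain ⟨a, rfl⟩ := ofKernel_surj f
    exact (ofKernel_comp_ofDet _ _).trans
      ((ofKernel_eq (reparam_unit_tensor a)).trans (ofDet_comp_ofKernel _ _).symm))
  (rightUnitor_naturality := fun f => by
    obtain ⟨a, rfl⟩ := ofKernel_surj f
    exact (ofKernel_comp_ofDet _ _).trans
      ((ofKernel_eq (reparam_tensor_unit a)).trans (ofDet_comp_ofKernel _ _).symm))
  (pentagon := fun W X Y Z => by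
    have e1 : (α_ W X Y).hom ⊗ₘ 𝟙 Z = ofDet (X := ((W ⊗ X) ⊗ Y) ⊗ Z) (Y := (W ⊗ X ⊗ Y) ⊗ Z)
        ((α_ W.obj X.obj Y.obj).hom ⊗ₘ 𝟙 Z.obj) := ofDet_tensor _ _
    have e2 : 𝟙 W ⊗ₘ (α_ X Y Z).hom = ofDet (X := W ⊗ (X ⊗ Y) ⊗ Z) (Y := W ⊗ X ⊗ Y ⊗ Z)
        (𝟙 W.obj ⊗ₘ (α_ X.obj Y.obj Z.obj).hom) := ofDet_tensor _ _
    rw [e1, e2]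
    exact ((congrArg _ (ofDet_comp_ofDet _ _)).trans (ofDet_comp_ofDet _ _)).trans
      ((ofDet_congr (by
        rw [id_tensorHom, tensorHom_id]; exact MonoidalCategory.pentagon _ _ _ _)).trans
        (ofDet_comp_ofDet _ _).symm))
  (triangle := fun X Y => by
    have e1 : 𝟙 X ⊗ₘ (λ_ Y).hom = ofDet (X := X ⊗ 𝟙_ _ ⊗ Y) (Y := X ⊗ Y)
        (𝟙 X.obj ⊗ₘ (λ_ Y.obj).hom) := ofDet_tensor _ _
    have e2 : (ρ_ X).hom ⊗ₘ 𝟙 Y = ofDet (X := (X ⊗ 𝟙_ _) ⊗ Y) (Y := X ⊗ Y)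
        ((ρ_ X.obj).hom ⊗ₘ 𝟙 Y.obj) := ofDet_tensor _ _
    rw [e1, e2]
    exact (ofDet_comp_ofDet _ _).trans (ofDet_congr (by
      rw [id_tensorHom, tensorHom_id]; exact MonoidalCategory.triangle _ _)))

lemma ofDet_whiskerLeft (X : Joint C) {Y Z : Joint C} (h : Y.obj ⟶ Z.obj) [Deterministic h] :
    X ◁ (ofDet h : Y ⟶ Z) = ofDet (X := X ⊗ Y) (Y := X ⊗ Z) (X.obj ◁ h) :=
  (ofDet_tensor (𝟙 X.obj) h).trans (ofDet_congr (id_tensorHom _ _))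

lemma ofDet_whiskerRight {Y Z : Joint C} (h : Y.obj ⟶ Z.obj) [Deterministic h] (X : Joint C) :
    (ofDet h : Y ⟶ Z) ▷ X = ofDet (X := Y ⊗ X) (Y := Z ⊗ X) (h ▷ X.obj) :=
  (ofDet_tensor h (𝟙 X.obj)).trans (ofDet_congr (tensorHom_id _ _))

lemma braiding_natural {X X' Y Y' : Joint C} (f : X ⟶ X') (g : Y ⟶ Y') :
    (f ⊗ₘ g) ≫ ofDet (X := X' ⊗ Y') (Y := Y' ⊗ X') (β_ X'.obj Y'.obj).hom =
      ofDet (X := X ⊗ Y) (Y := Y ⊗ X) (β_ X.obj Y.obj).hom ≫ (g ⊗ₘ f) := by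
  obtain ⟨a, rfl⟩ := ofKernel_surj f
  obtain ⟨b, rfl⟩ := ofKernel_surj g
  exact (ofKernel_comp_ofDet _ _).trans
    ((ofKernel_eq (reparam_tensor_braiding a b)).trans (ofDet_comp_ofKernel _ _).symm)

instance : SymmetricCategory (Joint C) where
  braiding X Y := isoOfDet (β_ X.obj Y.obj)
  braiding_naturality_right X _ _ f := braiding_natural (𝟙 X) f
  braiding_naturality_left f X := braiding_natural f (𝟙 X)
  hexagon_forward X Y Z := by
    refine ((congrArg _ (ofDet_comp_ofDet _ _)).trans (ofDet_comp_ofDet _ _)).trans (Eq.symm ?_)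
    refine (congrArg₂ (· ≫ ·) (ofDet_whiskerRight (Y := X ⊗ Y) (Z := Y ⊗ X) (β_ X.obj Y.obj).hom Z)
      (congrArg (_ ≫ ·)
        (ofDet_whiskerLeft Y (Y := X ⊗ Z) (Z := Z ⊗ X) (β_ X.obj Z.obj).hom))).trans ?_
    refine ((congrArg _ (ofDet_comp_ofDet _ _)).trans (ofDet_comp_ofDet _ _)).trans ?_
    exact ofDet_congr (BraidedCategory.hexagon_forward _ _ _).symm
  hexagon_reverse X Y Z := by
    refine ((congrArg _ (ofDet_comp_ofDet _ _)).trans (ofDet_comp_ofDet _ _)).trans (Eq.symm ?_)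
    refine (congrArg₂ (· ≫ ·) (ofDet_whiskerLeft X (Y := Y ⊗ Z) (Z := Z ⊗ Y) (β_ Y.obj Z.obj).hom)
      (congrArg (_ ≫ ·)
        (ofDet_whiskerRight (Y := X ⊗ Z) (Z := Z ⊗ X) (β_ X.obj Z.obj).hom Y))).trans ?_
    refine ((congrArg _ (ofDet_comp_ofDet _ _)).trans (ofDet_comp_ofDet _ _)).trans ?_
    exact ofDet_congr (BraidedCategory.hexagon_reverse _ _ _).symm
  symmetry X Y := (ofDet_comp_ofDet _ _).trans (ofDet_congr (SymmetricCategory.symmetry _ _))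

instance (X : Joint C) : ComonObj X where
  counit := ofDet (X := X) (Y := 𝟙_ _) ε[X.obj]
  comul := ofDet (X := X) (Y := X ⊗ X) Δ[X.obj]
  counit_comul := (congrArg (_ ≫ ·) (ofDet_whiskerRight (Y := X) (Z := 𝟙_ _) ε[X.obj] X)).trans
    ((ofDet_comp_ofDet _ _).trans (ofDet_congr (ComonObj.counit_comul X.obj)))
  comul_counit := (congrArg (_ ≫ ·) (ofDet_whiskerLeft X (Y := X) (Z := 𝟙_ _) ε[X.obj])).trans
    ((ofDet_comp_ofDet _ _).trans (ofDet_congr (ComonObj.comul_counit X.obj)))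
  comul_assoc := by
    refine (congrArg (_ ≫ ·) (ofDet_whiskerLeft X (Y := X) (Z := X ⊗ X) Δ[X.obj])).trans
      ((ofDet_comp_ofDet _ _).trans (Eq.symm ?_))
    refine (congrArg (_ ≫ ·) (congrArg (· ≫ _)
      (ofDet_whiskerRight (Y := X) (Z := X ⊗ X) Δ[X.obj] X))).trans ?_
    refine ((congrArg _ (ofDet_comp_ofDet _ _)).trans (ofDet_comp_ofDet _ _)).trans ?_
    exact ofDet_congr (ComonObj.comul_assoc X.obj).symm

lemma copy_eq (X : Joint C) : Δ[X] = ofDet (X := X) (Y := X ⊗ X) Δ[X.obj] := rfl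
lemma discard_eq (X : Joint C) : ε[X] = ofDet (X := X) (Y := 𝟙_ _) ε[X.obj] := rfl

lemma ofDet_tensorμ (X Y Z W : Joint C) : tensorμ X Y Z W =
    ofDet (X := (X ⊗ Y) ⊗ Z ⊗ W) (Y := (X ⊗ Z) ⊗ Y ⊗ W) (tensorμ X.obj Y.obj Z.obj W.obj) := by
  have e : X ◁ (β_ Y Z).hom ▷ W = ofDet (X := X ⊗ (Y ⊗ Z) ⊗ W) (Y := X ⊗ (Z ⊗ Y) ⊗ W)
      (X.obj ◁ (β_ Y.obj Z.obj).hom ▷ W.obj) :=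
    (congrArg (X ◁ ·) (ofDet_whiskerRight (Y := Y ⊗ Z) (Z := Z ⊗ Y) _ W)).trans
      (ofDet_whiskerLeft X (Y := (Y ⊗ Z) ⊗ W) (Z := (Z ⊗ Y) ⊗ W) _)
  have e2 : X ◁ (α_ Y Z W).inv = ofDet (X := X ⊗ Y ⊗ Z ⊗ W) (Y := X ⊗ (Y ⊗ Z) ⊗ W)
      (X.obj ◁ (α_ Y.obj Z.obj W.obj).inv) :=
    ofDet_whiskerLeft X (Y := Y ⊗ Z ⊗ W) (Z := (Y ⊗ Z) ⊗ W) _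
  have e3 : X ◁ (α_ Z Y W).hom = ofDet (X := X ⊗ (Z ⊗ Y) ⊗ W) (Y := X ⊗ Z ⊗ Y ⊗ W)
      (X.obj ◁ (α_ Z.obj Y.obj W.obj).hom) :=
    ofDet_whiskerLeft X (Y := (Z ⊗ Y) ⊗ W) (Z := Z ⊗ Y ⊗ W) _
  rw [tensorμ, e, e2, e3]
  have h {A₁ A₂ A₃ A₄ A₅ A₆ : Joint C} (a : A₁.obj ⟶ A₂.obj) (b : A₂.obj ⟶ A₃.obj)
      (c : A₃.obj ⟶ A₄.obj) (d : A₄.obj ⟶ A₅.obj) (e : A₅.obj ⟶ A₆.obj) [Deterministic a]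
      [Deterministic b] [Deterministic c] [Deterministic d] [Deterministic e] :
      (ofDet a : A₁ ⟶ A₂) ≫ (ofDet b : A₂ ⟶ A₃) ≫ (ofDet c : A₃ ⟶ A₄) ≫
        (ofDet d : A₄ ⟶ A₅) ≫ (ofDet e : A₅ ⟶ A₆) = ofDet (a ≫ b ≫ c ≫ d ≫ e) := by
    simp only [ofDet_comp_ofDet]
  exact h (A₂ := X ⊗ Y ⊗ Z ⊗ W) (A₃ := X ⊗ (Y ⊗ Z) ⊗ W) (A₄ := X ⊗ (Z ⊗ Y) ⊗ W)
    (A₅ := X ⊗ Z ⊗ Y ⊗ W) (α_ X.obj Y.obj (Z.obj ⊗ W.obj)).hom (X.obj ◁ (α_ Y.obj Z.obj W.obj).inv)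
    (X.obj ◁ (β_ Y.obj Z.obj).hom ▷ W.obj) (X.obj ◁ (α_ Z.obj Y.obj W.obj).hom)
    (α_ X.obj Z.obj (Y.obj ⊗ W.obj)).inv

instance (X : Joint C) : IsCommComonObj X where
  comul_comm := (ofDet_comp_ofDet _ _).trans (ofDet_congr (IsCommComonObj.comul_comm X.obj))

instance : CopyDiscardCategory (Joint C) where
  copy_tensor X Y := by
    rw [ofDet_tensorμ]
    refine Eq.trans ?_ (congrArg (· ≫ _) (ofDet_tensor (Y := X ⊗ X) (Y' := Y ⊗ Y) _ _)).symm
    exact (ofDet_congr (CopyDiscardCategory.copy_tensor _ _)).trans (ofDet_comp_ofDet _ _).symm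
  discard_tensor X Y := by
    refine Eq.trans ?_ (congrArg (· ≫ _) (ofDet_tensor (Y := 𝟙_ _) (Y' := 𝟙_ _) _ _)).symm
    exact (ofDet_congr (CopyDiscardCategory.discard_tensor _ _)).trans (ofDet_comp_ofDet _ _).symm
  copy_unit := ofDet_congr CopyDiscardCategory.copy_unit
  discard_unit := ofDet_congr CopyDiscardCategory.discard_unit

instance : MarkovCategory (Joint C) where
  discard_natural f := by
    obtain ⟨a, rfl⟩ := ofKernel_surj f
    exact (ofKernel_comp_ofDet _ _).trans (ofKernel_eq (reparam_discard a))

end Joint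
/-! ### Strict Markov categories and strict Markov functors -/

/-- A monoidal category is strict when the associators and unitors are identities. -/
class StrictMonoidalCategory (C : Type u) [Category.{v} C] [MonoidalCategory C] : Prop where
  tensor_assoc (X Y Z : C) : (X ⊗ Y) ⊗ Z = X ⊗ (Y ⊗ Z)
  unit_tensor (X : C) : 𝟙_ C ⊗ X = X
  tensor_unit (X : C) : X ⊗ 𝟙_ C = X
  associator_hom (X Y Z : C) : (α_ X Y Z).hom = eqToHom (tensor_assoc X Y Z)
  leftUnitor_hom (X : C) : (λ_ X).hom = eqToHom (unit_tensor X)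
  rightUnitor_hom (X : C) : (ρ_ X).hom = eqToHom (tensor_unit X)

/-- A strict Markov functor between strict Markov categories: it preserves, on the nose, the
tensor product, the symmetry, and the copy and discard maps. The associators and unitors,
being identities, are preserved automatically. -/
structure StrictMarkovFunctor (C : Type u₁) [Category.{v₁} C] [MonoidalCategory C]
    [MarkovCategory C] (D : Type u₂) [Category.{v₂} D] [MonoidalCategory D] [MarkovCategory D]
    extends C ⥤ D where
  obj_unit : obj (𝟙_ C) = 𝟙_ D
  obj_tensor (X Y : C) : obj (X ⊗ Y) = obj X ⊗ obj Y
  map_tensor {X Y X' Y' : C} (f : X ⟶ Y) (g : X' ⟶ Y') : map (f ⊗ₘ g) =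
    eqToHom (obj_tensor X X') ≫ (map f ⊗ₘ map g) ≫ eqToHom (obj_tensor Y Y').symm
  map_braiding (X Y : C) : map (β_ X Y).hom =
    eqToHom (obj_tensor X Y) ≫ (β_ (obj X) (obj Y)).hom ≫ eqToHom (obj_tensor Y X).symm
  map_copy (X : C) : map Δ[X] = Δ[obj X] ≫ eqToHom (obj_tensor X X).symm
  map_discard (X : C) : map ε[X] = ε[obj X] ≫ eqToHom obj_unit.symm

/-! ### Signatures and free Markov categories -/

/-- A hypergraph, used as a monoidal signature: wires, and boxes with lists of wires as domain and
codomain. -/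
structure MonoidalSignature where
  /-- the wires -/
  W : Type w
  /-- the boxes -/
  B : Type w'
  /-- the domain of a box -/
  dom : B → List W
  /-- the codomain of a box -/
  cod : B → List W

/-- String diagrams over a signature, as formal expressions built from the boxes and the structure
maps of a strict Markov category. The expression `cast h` is the identity, allowed to change its
type along an equality of lists of wires (such as `(a ++ b) ++ c = a ++ (b ++ c)`). -/
inductive Diagram (S : MonoidalSignature.{w, w'}) : List S.W → List S.W → Type (max w w')
  | box (b : S.B) : Diagram S (S.dom b) (S.cod b)
  | cast {a b : List S.W} (h : a = b) : Diagram S a b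
  | comp {a b c : List S.W} (f : Diagram S a b) (g : Diagram S b c) : Diagram S a c
  | tensor {a b c d : List S.W} (f : Diagram S a b) (g : Diagram S c d) :
      Diagram S (a ++ c) (b ++ d)
  | swap (a b : List S.W) : Diagram S (a ++ b) (b ++ a)
  | copy (a : List S.W) : Diagram S a (a ++ a)
  | discard (a : List S.W) : Diagram S a []

namespace Diagram

/-- The identity diagram. -/
abbrev one {S : MonoidalSignature.{w, w'}} (a : List S.W) : Diagram S a a := cast rfl

/-- The exchange of the two middle bundles of wires. -/
def exchange {S : MonoidalSignature.{w, w'}} (a b c d : List S.W) :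
    Diagram S ((a ++ b) ++ (c ++ d)) ((a ++ c) ++ (b ++ d)) :=
  (cast (List.append_assoc a b (c ++ d))).comp
    (((one a).tensor (cast (List.append_assoc b c d).symm)).comp
      (((one a).tensor ((swap b c).tensor (one d))).comp
        (((one a).tensor (cast (List.append_assoc c b d))).comp
          (cast (List.append_assoc a c (b ++ d)).symm))))

/-- The equations of strict Markov categories. -/
inductive Rel {S : MonoidalSignature.{w, w'}} : ∀ {a b : List S.W}, Diagram S a b → Diagram S a b → Prop
  | comp_left {a b c : List S.W} {f f' : Diagram S a b} (h : Rel f f') (g : Diagram S b c) :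
      Rel (f.comp g) (f'.comp g)
  | comp_right {a b c : List S.W} (f : Diagram S a b) {g g' : Diagram S b c} (h : Rel g g') :
      Rel (f.comp g) (f.comp g')
  | tensor_left {a b c d : List S.W} {f f' : Diagram S a b} (h : Rel f f') (g : Diagram S c d) :
      Rel (f.tensor g) (f'.tensor g)
  | tensor_right {a b c d : List S.W} (f : Diagram S a b) {g g' : Diagram S c d} (h : Rel g g') :
      Rel (f.tensor g) (f.tensor g')
  | id_comp {a b : List S.W} (f : Diagram S a b) : Rel ((one a).comp f) f
  | comp_id {a b : List S.W} (f : Diagram S a b) : Rel (f.comp (one b)) f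
  | assoc {a b c d : List S.W} (f : Diagram S a b) (g : Diagram S b c) (h : Diagram S c d) :
      Rel ((f.comp g).comp h) (f.comp (g.comp h))
  | tensor_id (a b : List S.W) : Rel ((one a).tensor (one b)) (one (a ++ b))
  | tensor_comp {a b c a' b' c' : List S.W} (f : Diagram S a b) (g : Diagram S b c)
      (f' : Diagram S a' b') (g' : Diagram S b' c') :
      Rel ((f.tensor f').comp (g.tensor g')) ((f.comp g).tensor (f'.comp g'))
  | tensor_assoc {a b c a' b' c' : List S.W} (f : Diagram S a a') (g : Diagram S b b')
      (h : Diagram S c c') :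
      Rel (((f.tensor g).tensor h).comp (cast (List.append_assoc a' b' c')))
        ((cast (List.append_assoc a b c)).comp (f.tensor (g.tensor h)))
  | unit_tensor {a b : List S.W} (f : Diagram S a b) :
      Rel (((one []).tensor f).comp (cast (List.nil_append b))) ((cast (List.nil_append a)).comp f)
  | tensor_unit {a b : List S.W} (f : Diagram S a b) :
      Rel ((f.tensor (one [])).comp (cast (List.append_nil b))) ((cast (List.append_nil a)).comp f)
  | swap_natural {a b c d : List S.W} (f : Diagram S a b) (g : Diagram S c d) :
      Rel ((f.tensor g).comp (swap b d)) ((swap a c).comp (g.tensor f))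
  | swap_swap (a b : List S.W) : Rel ((swap a b).comp (swap b a)) (one (a ++ b))
  | hexagon_forward (a b c : List S.W) :
      Rel ((cast (List.append_assoc a b c)).comp
          ((swap a (b ++ c)).comp (cast (List.append_assoc b c a))))
        (((swap a b).tensor (one c)).comp
          ((cast (List.append_assoc b a c)).comp ((one b).tensor (swap a c))))
  | hexagon_reverse (a b c : List S.W) :
      Rel ((cast (List.append_assoc a b c).symm).comp
          ((swap (a ++ b) c).comp (cast (List.append_assoc c a b).symm)))
        (((one a).tensor (swap b c)).comp
          ((cast (List.append_assoc a c b).symm).comp ((swap a c).tensor (one b))))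
  | copy_discard_left (a : List S.W) :
      Rel ((copy a).comp ((discard a).tensor (one a))) (cast (List.nil_append a).symm)
  | copy_discard_right (a : List S.W) :
      Rel ((copy a).comp ((one a).tensor (discard a))) (cast (List.append_nil a).symm)
  | copy_assoc (a : List S.W) :
      Rel ((copy a).comp ((one a).tensor (copy a)))
        ((copy a).comp (((copy a).tensor (one a)).comp (cast (List.append_assoc a a a))))
  | copy_comm (a : List S.W) : Rel ((copy a).comp (swap a a)) (copy a)
  | copy_tensor (a b : List S.W) :
      Rel (copy (a ++ b)) (((copy a).tensor (copy b)).comp (exchange a a b b))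
  | copy_unit : Rel (copy []) (one [])
  | discard_natural {a b : List S.W} (f : Diagram S a b) : Rel (f.comp (discard b)) (discard a)
  | discard_unit : Rel (discard []) (one [])

end Diagram

/-- The free (strict) Markov category on a signature: its objects are lists of wires. -/
structure FreeMarkov (S : MonoidalSignature.{w, w'}) where
  /-- the underlying list of wires -/
  wires : List S.W

namespace FreeMarkov

variable {S : MonoidalSignature.{w, w'}}

/-- Morphisms are string diagrams modulo the equations of strict Markov categories. -/
instance : CategoryStruct.{max w w'} (FreeMarkov S) where
  Hom X Y := Quot (Diagram.Rel (S := S) (a := X.wires) (b := Y.wires))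
  id X := Quot.mk _ (.one X.wires)
  comp := Quot.map₂ .comp (fun f _ _ h => .comp_right f h) (fun _ _ g h => .comp_left h g)

/-- The morphism given by a diagram. -/
def of {a b : List S.W} (f : Diagram S a b) : (⟨a⟩ : FreeMarkov S) ⟶ ⟨b⟩ := Quot.mk _ f

/-- The morphism given by a single box. -/
def box (b : S.B) : (⟨S.dom b⟩ : FreeMarkov S) ⟶ ⟨S.cod b⟩ := of (.box b)

lemma of_surj {X Y : FreeMarkov S} (f : X ⟶ Y) : ∃ d : Diagram S X.wires Y.wires, f = of d := by
  obtain ⟨a, rfl⟩ := Quot.exists_rep f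
  exact ⟨a, rfl⟩

instance : Category.{max w w'} (FreeMarkov S) where
  id_comp f := by
    obtain ⟨f, rfl⟩ := of_surj f
    exact Quot.sound (.id_comp f)
  comp_id f := by
    obtain ⟨f, rfl⟩ := of_surj f
    exact Quot.sound (.comp_id f)
  assoc f g h := by
    obtain ⟨f, rfl⟩ := of_surj f
    obtain ⟨g, rfl⟩ := of_surj g
    obtain ⟨h, rfl⟩ := of_surj h
    exact Quot.sound (.assoc f g h)

lemma of_comp {a b c : List S.W} (f : Diagram S a b) (g : Diagram S b c) :
    of f ≫ of g = of (f.comp g) := rfl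

lemma of_cast_comp_cast {a b c : List S.W} (h : a = b) (h' : b = c) :
    of (S := S) (.cast h) ≫ of (.cast h') = of (.cast (h.trans h')) := by
  subst h
  exact Quot.sound (.id_comp _)

lemma of_cast {a b : List S.W} (h : a = b) :
    of (S := S) (.cast h) = eqToHom (congrArg mk h) := by
  subst h; rfl

/-- The isomorphism given by an equality of lists of wires. -/
def castIso {X Y : FreeMarkov S} (h : X.wires = Y.wires) : X ≅ Y where
  hom := of (.cast h)
  inv := of (.cast h.symm)
  hom_inv_id := of_cast_comp_cast _ _
  inv_hom_id := of_cast_comp_cast _ _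

instance : MonoidalCategoryStruct (FreeMarkov S) where
  tensorObj X Y := ⟨X.wires ++ Y.wires⟩
  tensorUnit := ⟨[]⟩
  tensorHom := Quot.map₂ .tensor (fun f _ _ h => .tensor_right f h) (fun _ _ g h => .tensor_left h g)
  whiskerLeft X _ _ := Quot.map (.tensor (.one X.wires)) (fun _ _ h => .tensor_right _ h)
  whiskerRight f Y := Quot.map (fun d => d.tensor (.one Y.wires)) (fun _ _ h => .tensor_left h _) f
  associator _ _ _ := castIso (List.append_assoc _ _ _)
  leftUnitor _ := castIso (List.nil_append _)
  rightUnitor _ := castIso (List.append_nil _)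

lemma of_tensor {a b c d : List S.W} (f : Diagram S a b) (g : Diagram S c d) :
    of f ⊗ₘ of g = of (f.tensor g) := rfl

lemma of_cast_tensor_cast {a b c d : List S.W} (h : a = b) (h' : c = d) :
    of (S := S) ((Diagram.cast h).tensor (.cast h')) = of (.cast (by rw [h, h'])) := by
  subst h h'
  exact Quot.sound (.tensor_id _ _)

instance : MonoidalCategory (FreeMarkov S) := .ofTensorHom
  (id_tensorHom_id := fun _ _ => Quot.sound (.tensor_id _ _))
  (id_tensorHom := fun X _ _ f => by obtain ⟨f, rfl⟩ := of_surj f; rfl)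
  (tensorHom_id := fun f _ => by obtain ⟨f, rfl⟩ := of_surj f; rfl)
  (tensorHom_comp_tensorHom := fun f f' g g' => by
    obtain ⟨f, rfl⟩ := of_surj f
    obtain ⟨f', rfl⟩ := of_surj f'
    obtain ⟨g, rfl⟩ := of_surj g
    obtain ⟨g', rfl⟩ := of_surj g'
    exact Quot.sound (.tensor_comp _ _ _ _))
  (associator_naturality := fun f g h => by
    obtain ⟨f, rfl⟩ := of_surj f
    obtain ⟨g, rfl⟩ := of_surj g
    obtain ⟨h, rfl⟩ := of_surj h
    exact Quot.sound (.tensor_assoc _ _ _))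
  (leftUnitor_naturality := fun f => by
    obtain ⟨f, rfl⟩ := of_surj f
    exact Quot.sound (.unit_tensor _))
  (rightUnitor_naturality := fun f => by
    obtain ⟨f, rfl⟩ := of_surj f
    exact Quot.sound (.tensor_unit _))
  (pentagon := fun W X Y Z => by
    refine (congrArg₂ (· ≫ ·) (of_cast_tensor_cast _ _) (congrArg (_ ≫ ·)
      (of_cast_tensor_cast _ _))).trans ?_
    exact ((congrArg _ (of_cast_comp_cast _ _)).trans (of_cast_comp_cast _ _)).trans
      (of_cast_comp_cast _ _).symm)
  (triangle := fun X Y =>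
    (congrArg (_ ≫ ·) (of_cast_tensor_cast _ _)).trans ((of_cast_comp_cast _ _).trans
      (of_cast_tensor_cast _ _).symm))

instance : StrictMonoidalCategory (FreeMarkov S) where
  tensor_assoc _ _ _ := congrArg mk (List.append_assoc _ _ _)
  unit_tensor _ := rfl
  tensor_unit _ := congrArg mk (List.append_nil _)
  associator_hom _ _ _ := of_cast _
  leftUnitor_hom _ := of_cast _
  rightUnitor_hom _ := of_cast _

instance : SymmetricCategory (FreeMarkov S) where
  braiding X Y :=
    { hom := of (.swap X.wires Y.wires)
      inv := of (.swap Y.wires X.wires)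
      hom_inv_id := Quot.sound (.swap_swap _ _)
      inv_hom_id := Quot.sound (.swap_swap _ _) }
  braiding_naturality_right X _ _ f := by
    obtain ⟨f, rfl⟩ := of_surj f
    exact Quot.sound (.swap_natural _ _)
  braiding_naturality_left f X := by
    obtain ⟨f, rfl⟩ := of_surj f
    exact Quot.sound (.swap_natural _ _)
  hexagon_forward _ _ _ := Quot.sound (.hexagon_forward _ _ _)
  hexagon_reverse _ _ _ := Quot.sound (.hexagon_reverse _ _ _)
  symmetry _ _ := Quot.sound (.swap_swap _ _)

instance (X : FreeMarkov S) : ComonObj X where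
  counit := of (.discard X.wires)
  comul := of (.copy X.wires)
  counit_comul := Quot.sound (.copy_discard_left _)
  comul_counit := Quot.sound (.copy_discard_right _)
  comul_assoc := Quot.sound (.copy_assoc _)

instance (X : FreeMarkov S) : IsCommComonObj X where
  comul_comm := Quot.sound (.copy_comm _)

lemma eq_discard {X : FreeMarkov S} (f : X ⟶ 𝟙_ (FreeMarkov S)) : f = ε[X] := by
  obtain ⟨f, rfl⟩ := of_surj f
  refine (Quot.sound (.comp_id f)).symm.trans (Eq.trans ?_ (Quot.sound (.discard_natural f)))
  exact congrArg (of f ≫ ·) (Quot.sound .discard_unit).symm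

instance : CopyDiscardCategory (FreeMarkov S) where
  copy_tensor _ _ := Quot.sound (.copy_tensor _ _)
  discard_tensor _ _ := (eq_discard _).symm
  copy_unit := Quot.sound .copy_unit
  discard_unit := Quot.sound .discard_unit

instance : MarkovCategory (FreeMarkov S) where
  discard_natural f := by
    obtain ⟨f, rfl⟩ := of_surj f
    exact Quot.sound (.discard_natural f)

end FreeMarkov
/-! ### Markov categories containing the Markov kernels between standard Borel spaces -/

instance (C : Type u) [Category.{v} C] [MonoidalCategory C] [MarkovCategory C]
    [StrictMonoidalCategory C] : StrictMonoidalCategory (Joint C) := by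
  have key {X Y : C} (h : X = Y) (f : X ⟶ Y) [Deterministic f] (hf : f = eqToHom h) :
      (Joint.ofDet f : (⟨X⟩ : Joint C) ⟶ ⟨Y⟩) = eqToHom (congrArg Joint.mk h) := by
    subst h; subst hf; rfl
  exact
    { tensor_assoc := fun X Y Z =>
        congrArg Joint.mk (StrictMonoidalCategory.tensor_assoc X.obj Y.obj Z.obj)
      unit_tensor := fun X => congrArg Joint.mk (StrictMonoidalCategory.unit_tensor X.obj)
      tensor_unit := fun X => congrArg Joint.mk (StrictMonoidalCategory.tensor_unit X.obj)
      associator_hom := fun _ _ _ => key _ _ (StrictMonoidalCategory.associator_hom _ _ _)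
      leftUnitor_hom := fun _ => key _ _ (StrictMonoidalCategory.leftUnitor_hom _)
      rightUnitor_hom := fun _ => key _ _ (StrictMonoidalCategory.rightUnitor_hom _) }

/-- A Markov category `M` containing a full monoidal subcategory `P` of the category `Stoch` of
measurable spaces and Markov kernels, to which all standard Borel spaces belong. The inclusion is a
symmetric monoidal functor which preserves copying (and hence discarding). -/
structure KernelInclusion (P : ObjectProperty Stoch.{0}) [P.IsMonoidal] (M : Type u)
    [Category.{v} M] [MonoidalCategory M] [MarkovCategory M] where
  /-- the inclusion -/
  incl : P.FullSubcategory ⥤ M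
  [braided : incl.Braided]
  standardBorel (X : Stoch.{0}) (hX : StandardBorelSpace X.obj) : P X
  map_copy (X : P.FullSubcategory) :
    incl.map (ObjectProperty.homMk Δ[X.obj] : X ⟶ X ⊗ X) ≫ Functor.OplaxMonoidal.δ incl X X =
      Δ[incl.obj X]

attribute [instance] KernelInclusion.braided

namespace KernelInclusion

variable {P : ObjectProperty Stoch.{0}} [P.IsMonoidal] {M : Type u} [Category.{v} M]
  [MonoidalCategory M] [MarkovCategory M] (J : KernelInclusion P M)

/-- The unit interval, with its Borel sets. -/
def interval : P.FullSubcategory :=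
  ⟨⟨SFinKer.of unitInterval⟩, J.standardBorel _ inferInstance⟩

/-- A probability measure on the unit interval, as a Markov kernel from the one-point space. -/
noncomputable def measureHom (μ : MeasureTheory.Measure unitInterval)
    [MeasureTheory.IsProbabilityMeasure μ] :
    (⟨SFinKer.of PUnit⟩ : Stoch.{0}) ⟶ ⟨SFinKer.of unitInterval⟩ :=
  ⟨⟨ProbabilityTheory.Kernel.const PUnit μ, inferInstance⟩,
    (inferInstance : ProbabilityTheory.IsMarkovKernel (ProbabilityTheory.Kernel.const PUnit μ))⟩

/-- A probability measure on the unit interval, as a morphism of `M`. -/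
noncomputable def ofMeasure (μ : MeasureTheory.Measure unitInterval)
    [MeasureTheory.IsProbabilityMeasure μ] : 𝟙_ M ⟶ J.incl.obj J.interval :=
  Functor.LaxMonoidal.ε J.incl ≫
    J.incl.map (ObjectProperty.homMk (measureHom μ) : 𝟙_ P.FullSubcategory ⟶ J.interval)

/-- The uniform distribution on the unit interval. -/
noncomputable def uniform : 𝟙_ M ⟶ J.incl.obj J.interval := J.ofMeasure MeasureTheory.volume

/-- The point `t` of the unit interval. -/
noncomputable def point (t : unitInterval) : 𝟙_ M ⟶ J.incl.obj J.interval :=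
  J.ofMeasure (MeasureTheory.Measure.dirac t)

/-- The kernel `z ↦ g(u, z)`, where `u` is drawn from `p`. -/
noncomputable def feed {Z R : M} (p : 𝟙_ M ⟶ J.incl.obj J.interval)
    (g : J.incl.obj J.interval ⊗ Z ⟶ R) : Z ⟶ R := (λ_ Z).inv ≫ (p ▷ Z) ≫ g

/-- A morphism of `M` which is, up to deterministic isomorphisms, a Markov kernel into a standard
Borel space. -/
def IsStandardBorelKernel {Z R : M} (f : Z ⟶ R) : Prop :=
  ∃ (A B : P.FullSubcategory) (_ : StandardBorelSpace B.obj.obj) (κ : A ⟶ B)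
    (e : Z ≅ J.incl.obj A) (e' : J.incl.obj B ≅ R),
    Deterministic e.hom ∧ Deterministic e'.hom ∧ f = e.hom ≫ J.incl.map κ ≫ e'.hom

end KernelInclusion

/-! ### Joint factorizations and counterfactuals -/

/-- A joint factorization `(f, φ, F)` over the signature `S`: a labelling of the boxes with lists of
residual wires, a strict Markov functor `F` into `Joint M` which sends each box `b` to a joint
Markov kernel with residual object `F (res b)`, a string diagram `φ` and its image `f`. -/
structure JointFactorization (S : MonoidalSignature.{w, w'}) (M : Type u) [Category.{v} M]
    [MonoidalCategory M] [MarkovCategory M] where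
  /-- the residual wires of a box -/
  res : S.B → List S.W
  /-- the interpretation -/
  F : StrictMarkovFunctor (FreeMarkov S) (Joint M)
  /-- the mechanism of a box -/
  mech (b : S.B) : (F.obj ⟨res b⟩).obj ⊗ (F.obj ⟨S.dom b⟩).obj ⟶ (F.obj ⟨S.cod b⟩).obj
  /-- the noise of a box -/
  noise (b : S.B) : (F.obj ⟨S.dom b⟩).obj ⟶ (F.obj ⟨res b⟩).obj
  [det (b : S.B) : Deterministic (mech b)]
  map_box (b : S.B) : F.map (FreeMarkov.box b) =
    Joint.ofKernel ⟨(F.obj ⟨res b⟩).obj, mech b, noise b⟩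
  /-- the domain of the causal model -/
  dom : FreeMarkov S
  /-- the codomain of the causal model -/
  cod : FreeMarkov S
  /-- the causal model -/
  φ : dom ⟶ cod
  /-- the factorized joint kernel -/
  f : F.obj dom ⟶ F.obj cod
  f_eq : f = F.map φ

attribute [instance] JointFactorization.det

namespace JointFactorization

variable {S : MonoidalSignature.{w, w'}} {P : ObjectProperty Stoch.{0}} [P.IsMonoidal] {M : Type u}
  [Category.{v} M] [MonoidalCategory M] [MarkovCategory M]

/-- An intervention: it assigns to each box either nothing or a deterministic point of its
codomain. -/
abbrev Intervention (𝓕 : JointFactorization S M) : Type _ :=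
  ∀ b : S.B, Unit ⊕ {x : 𝟙_ M ⟶ (𝓕.F.obj ⟨S.cod b⟩).obj // Deterministic x}

/-- `g` writes the noise of each box as the pushforward, along a deterministic map, of the uniform
distribution on the unit interval. -/
structure IsRandomization (𝓕 : JointFactorization S M) (J : KernelInclusion P M)
    (g : ∀ b : S.B, J.incl.obj J.interval ⊗ (𝓕.F.obj ⟨S.dom b⟩).obj ⟶ (𝓕.F.obj ⟨𝓕.res b⟩).obj) :
    Prop where
  det (b : S.B) : Deterministic (g b)
  feed_uniform (b : S.B) : J.feed J.uniform (g b) = 𝓕.noise b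

/-- The counterfactual joint kernel of a box: an intervened box ignores its input and returns the
assigned point; any other box keeps its mechanism, and its noise is evaluated at the variate
`U b`. -/
noncomputable def counterfactualBox (𝓕 : JointFactorization S M) (J : KernelInclusion P M)
    (g : ∀ b : S.B, J.incl.obj J.interval ⊗ (𝓕.F.obj ⟨S.dom b⟩).obj ⟶ (𝓕.F.obj ⟨𝓕.res b⟩).obj)
    (iv : 𝓕.Intervention) (U : S.B → unitInterval) (b : S.B) :
    𝓕.F.obj ⟨S.dom b⟩ ⟶ 𝓕.F.obj ⟨S.cod b⟩ :=
  match iv b with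
  | .inl _ => Joint.ofKernel ⟨(𝓕.F.obj ⟨𝓕.res b⟩).obj, 𝓕.mech b, J.feed (J.point (U b)) (g b)⟩
  | .inr x => have := x.2; Joint.ofDet (ε[(𝓕.F.obj ⟨S.dom b⟩).obj] ≫ x.1)

/-- `If` is the functor induced by the intervention and the variates: it agrees with the joint
factorization functor on objects, and it sends each box to its counterfactual joint kernel. -/
structure IsCounterfactual (𝓕 : JointFactorization S M) (J : KernelInclusion P M)
    (g : ∀ b : S.B, J.incl.obj J.interval ⊗ (𝓕.F.obj ⟨S.dom b⟩).obj ⟶ (𝓕.F.obj ⟨𝓕.res b⟩).obj)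
    (iv : 𝓕.Intervention) (U : S.B → unitInterval)
    (If : StrictMarkovFunctor (FreeMarkov S) (Joint M)) : Prop where
  obj_eq (X : FreeMarkov S) : If.obj X = 𝓕.F.obj X
  map_box (b : S.B) : If.map (FreeMarkov.box b) =
    eqToHom (obj_eq _) ≫ 𝓕.counterfactualBox J g iv U b ≫ eqToHom (obj_eq _).symm

end JointFactorization
end CausalDiagram

open CausalDiagram

namespace CausalDiagram

/-! ### Randomization of kernels into standard Borel spaces -/

/-! The two assertions are independent: the first is measure theory carried into `M`, the second is
freeness.

For the noise, a Markov kernel into a standard Borel space can be sampled by a jointly measurable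
function of its input and one uniform variate (`exists_measurable_map_volume_eq`). Measurable maps
are deterministic morphisms of `Stoch`, so inside `P` each such kernel is a deterministic map with
the uniform distribution fed into its first argument (`exists_randomization`). The inclusion into
`M` preserves copying and is braided, so it sends deterministic morphisms to deterministic ones
(`det_map`) and its tensorator is deterministic (`det_μ`). Feeding the uniform distribution in `M`
is then the image of feeding it in `P` (`feed_map`), and conjugating by the given deterministic
isomorphisms produces `g_b`.

For the counterfactual, boxes of a free Markov category may be sent anywhere with the right domain
and codomain. A diagram is evaluated recursively, with new values on the boxes and the object
assignment and structure maps of `F` (`interp`). The work is to see that evaluation respects the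
equations (`interp_eq_of_rel`). An equation without boxes already holds in the free category, so `F`
respects it; only the equations quantifying over arbitrary diagrams are verified in the target.
Uniqueness is induction on diagrams (`ext_of_box`): a strict Markov functor is forced on everything
built from boxes. The unique functor then determines the value at `φ`. -/

/-- A Markov kernel into a standard Borel space is the pushforward of the uniform distribution on
the unit interval along a jointly measurable family of maps. -/
lemma exists_measurable_map_volume_eq {X Y : Type*} [MeasurableSpace X] [MeasurableSpace Y]
    [StandardBorelSpace Y] (κ : ProbabilityTheory.Kernel X Y)
    [ProbabilityTheory.IsMarkovKernel κ] :
    ∃ f : unitInterval × X → Y, Measurable f ∧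
      ∀ x, MeasureTheory.volume.map (fun u => f (u, x)) = κ x := by
  rcases isEmpty_or_nonempty Y with hY | hY
  -- An empty target carries no probability measure, so a Markov kernel into it has empty source.
  -- This case is split off because the sampling theorem needs a point of `Y`.
  · have hX : IsEmpty X := ⟨fun x => by
      have h : κ x Set.univ = 1 := MeasureTheory.measure_univ
      rw [Set.univ_eq_empty_iff.mpr hY, MeasureTheory.measure_empty] at h
      exact zero_ne_one h⟩
    exact ⟨fun p => hX.elim p.2, measurable_of_empty _, fun x => hX.elim x⟩
  · obtain ⟨f, hf, h⟩ := κ.exists_measurable_map_eq_unitInterval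
    exact ⟨fun p => f p.2 p.1, hf.comp measurable_swap, h⟩

/-- At `x` the composite is the image under `f` of the product of `μ` with the Dirac mass at `x`,
and that product is itself the image of `μ` under `u ↦ (u, x)`. The left side is spelled out as the
kernel to which inverse unitor, whiskering and composition in `Stoch` unfold. -/
lemma _root_.ProbabilityTheory.Kernel.deterministic_comp_const_parallelComp_apply {U X Y : Type*}
    [MeasurableSpace U] [MeasurableSpace X] [MeasurableSpace Y] (μ : MeasureTheory.Measure U)
    [MeasureTheory.IsProbabilityMeasure μ] {f : U × X → Y} (hf : Measurable f) (x : X) :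
    (((ProbabilityTheory.Kernel.deterministic f hf).comp
      (ProbabilityTheory.Kernel.parallelComp (ProbabilityTheory.Kernel.const PUnit.{1} μ)
        (ProbabilityTheory.Kernel.id : ProbabilityTheory.Kernel X X))).comp
          ((ProbabilityTheory.Kernel.id : ProbabilityTheory.Kernel X X).map fun x => (PUnit.unit, x))) x =
      μ.map fun u => f (u, x) := by
  have hm : Measurable fun x : X => (PUnit.unit.{1}, x) := by fun_prop
  rw [ProbabilityTheory.Kernel.id_map hm, ProbabilityTheory.Kernel.comp_deterministic_eq_comap,
    ProbabilityTheory.Kernel.deterministic_comp_eq_map, ProbabilityTheory.Kernel.comap_apply,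
    ProbabilityTheory.Kernel.map_apply _ hf, ProbabilityTheory.Kernel.parallelComp_apply,
    ProbabilityTheory.Kernel.const_apply, ProbabilityTheory.Kernel.id_apply,
    MeasureTheory.Measure.prod_dirac, MeasureTheory.Measure.map_map hf (by fun_prop)]
  rfl

/-- A measurable map, as a morphism of `Stoch`. -/
noncomputable def stochOfMap {X Y : Stoch.{0}} (f : X.obj → Y.obj) (hf : Measurable f) : X ⟶ Y :=
  ⟨⟨ProbabilityTheory.Kernel.deterministic f hf, inferInstance⟩,
    (inferInstance : ProbabilityTheory.IsMarkovKernel (ProbabilityTheory.Kernel.deterministic f hf))⟩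

instance instDeterministicStochStochOfMap {X Y : Stoch.{0}} (f : X.obj → Y.obj) (hf : Measurable f) :
    Deterministic (stochOfMap f hf) := by
  unfold stochOfMap; infer_instance

/-! ### Transporting randomizations along the inclusion into `M` -/

namespace KernelInclusion

variable {P : ObjectProperty Stoch.{0}} [P.IsMonoidal] {M : Type*} [Category M]
  [MonoidalCategory M] [MarkovCategory M] (J : KernelInclusion P M)

lemma feed_stochOfMap {A B : Stoch.{0}} (μ : MeasureTheory.Measure unitInterval)
    [MeasureTheory.IsProbabilityMeasure μ] (κ : A ⟶ B) {f : unitInterval × A.obj → B.obj}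
    (hf : Measurable f) (h : ∀ x, μ.map (fun u => f (u, x)) = κ.hom.hom x) :
    (λ_ A).inv ≫ (measureHom μ ▷ A) ≫
      stochOfMap (X := (⟨SFinKer.of unitInterval⟩ : Stoch.{0}) ⊗ A) f hf = κ := by
  refine WideSubcategory.hom_ext _ (SFinKer.Hom.ext (ProbabilityTheory.Kernel.ext fun x => ?_))
  exact (ProbabilityTheory.Kernel.deterministic_comp_const_parallelComp_apply μ hf x).trans (h x)

/-- Fullness of `P` turns the measurable sampling map and the uniform distribution into morphisms of
the subcategory. Only the target must be standard Borel; the source is any object of `P`. -/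
lemma exists_randomization {A B : P.FullSubcategory} (hB : StandardBorelSpace B.obj.obj)
    (κ : A ⟶ B) : ∃ γ : J.interval ⊗ A ⟶ B, Deterministic γ.hom ∧
      (λ_ A).inv ≫ ((ObjectProperty.homMk (measureHom MeasureTheory.volume) :
        𝟙_ P.FullSubcategory ⟶ J.interval) ▷ A) ≫ γ = κ := by
  obtain ⟨f, hf, h⟩ := exists_measurable_map_volume_eq κ.hom.hom.hom
  have hdet := instDeterministicStochStochOfMap
    (X := (⟨SFinKer.of unitInterval⟩ : Stoch.{0}) ⊗ A.obj) f hf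
  exact ⟨ObjectProperty.homMk
    (stochOfMap (X := (⟨SFinKer.of unitInterval⟩ : Stoch.{0}) ⊗ A.obj) f hf), hdet,
    ObjectProperty.hom_ext _ (feed_stochOfMap _ κ.hom hf h)⟩

/-- Copying in the subcategory is copying in `Stoch` wrapped by `homMk`, so the tensor law can be
checked after forgetting to `Stoch`. -/
lemma copy_fullSubcategory_tensor (X Y : P.FullSubcategory) :
    (ObjectProperty.homMk Δ[(X ⊗ Y).obj] : X ⊗ Y ⟶ (X ⊗ Y) ⊗ (X ⊗ Y)) =
      ((ObjectProperty.homMk Δ[X.obj] : X ⟶ X ⊗ X) ⊗ₘ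
        (ObjectProperty.homMk Δ[Y.obj] : Y ⟶ Y ⊗ Y)) ≫ tensorμ X X Y Y := by
  ext : 1
  exact CopyDiscardCategory.copy_tensor X.obj Y.obj

open Functor.LaxMonoidal Functor.OplaxMonoidal in
-- Copying a tensor product means copying both factors and exchanging the middle ones. The inclusion
-- preserves copies, and being braided it carries the exchange in `P` to the exchange in `M`, so the
-- tensorator commutes with copying.
instance det_μ (X Y : P.FullSubcategory) : Deterministic (μ J.incl X Y) := det_of_comul _ (by
  have h' := tensorμ_comp_μ_tensorHom_μ_comp_μ J.incl X X Y Y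
  rw [← J.map_copy, copy_fullSubcategory_tensor, Functor.map_comp, Category.assoc,
    ← Functor.LaxMonoidal.μ_natural_assoc, CopyDiscardCategory.copy_tensor, ← J.map_copy,
    ← J.map_copy, ← tensorHom_comp_tensorHom]
  -- The coherence `h'` solved for the image of the exchange: the inverses `δ` cancel the two
  -- tensorators in front. The trailing `μ` then cancels the `δ` coming from `map_copy`.
  have h2 : μ J.incl (X ⊗ X) (Y ⊗ Y) ≫ J.incl.map (tensorμ X X Y Y) =
      (δ J.incl X X ⊗ₘ δ J.incl Y Y) ≫ tensorμ _ _ _ _ ≫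
        (μ J.incl X Y ⊗ₘ μ J.incl X Y) ≫ μ J.incl _ _ := by
    rw [h', tensorHom_comp_tensorHom_assoc]
    simp
  rw [reassoc_of% h2]
  simp)

/-- Copy-naturality of `h` is an equation in the subcategory; applying the functor and naturality of
`δ` moves it to `M`. -/
lemma det_map {X Y : P.FullSubcategory} (h : X ⟶ Y) [Deterministic h.hom] :
    Deterministic (J.incl.map h) := det_of_comul _ (by
  have e : h ≫ (ObjectProperty.homMk Δ[Y.obj] : Y ⟶ Y ⊗ Y) =
      (ObjectProperty.homMk Δ[X.obj] : X ⟶ X ⊗ X) ≫ (h ⊗ₘ h) := by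
    ext : 1
    exact Deterministic.copy_natural h.hom
  rw [← J.map_copy, ← J.map_copy, ← Functor.map_comp_assoc, e, Functor.map_comp]
  simp)

open Functor.LaxMonoidal in
-- The map `e` slides past the fed-in distribution. Naturality of the tensorator then pulls `m ▷ A`
-- inside the functor, and left unitality of the lax structure absorbs `ε` together with the unitor.
lemma feed_map {A B : P.FullSubcategory} {Z R : M} (m : 𝟙_ P.FullSubcategory ⟶ J.interval)
    (γ : J.interval ⊗ A ⟶ B) (e : Z ⟶ J.incl.obj A) (e' : J.incl.obj B ⟶ R) :
    J.feed (Functor.LaxMonoidal.ε J.incl ≫ J.incl.map m)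
      ((J.incl.obj J.interval ◁ e) ≫ μ J.incl _ _ ≫ J.incl.map γ ≫ e') =
      e ≫ J.incl.map ((λ_ A).inv ≫ (m ▷ A) ≫ γ) ≫ e' := by
  simp only [feed, Functor.map_comp, Category.assoc]
  rw [← whisker_exchange_assoc, ← leftUnitor_inv_naturality_assoc, comp_whiskerRight_assoc,
    μ_natural_left_assoc, Functor.LaxMonoidal.left_unitality_inv_assoc]

lemma IsStandardBorelKernel.exists_feed_uniform_eq {Z R : M} {f : Z ⟶ R}
    (hf : J.IsStandardBorelKernel f) :
    ∃ g : J.incl.obj J.interval ⊗ Z ⟶ R, Deterministic g ∧ J.feed J.uniform g = f := by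
  obtain ⟨A, B, hB, κ, e, e', he, he', rfl⟩ := hf
  obtain ⟨γ, hγ, h⟩ := J.exists_randomization hB κ
  have := J.det_map γ
  -- The sampling map `γ` conjugated by the two isomorphisms, with the tensorator bridging the
  -- product in `M` and the product in `P`. Every factor is deterministic.
  refine ⟨(J.incl.obj J.interval ◁ e.hom) ≫ Functor.LaxMonoidal.μ J.incl _ _ ≫ J.incl.map γ ≫ e'.hom,
    inferInstance, ?_⟩
  rw [uniform, ofMeasure, feed_map, h]

end KernelInclusion
end CausalDiagram


namespace CausalDiagram

universe v u w w'

/-! ### Strict Markov functors out of a free Markov category -/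

/-! ### Structure maps transported along equalities of objects -/

section EqToHom

variable {D : Type u} [Category.{v} D] [MonoidalCategory D]

lemma eqToHom_tensorHom_eqToHom {X X' Y Y' : D} (h : X = X') (k : Y = Y') :
    eqToHom h ⊗ₘ eqToHom k = eqToHom (congrArg₂ (· ⊗ ·) h k) := by
  subst h k; simp

lemma braiding_eqToHom [BraidedCategory D] {X X' Y Y' : D} (h : X = X') (k : Y = Y') :
    (β_ X Y).hom = eqToHom (congrArg₂ (· ⊗ ·) h k) ≫ (β_ X' Y').hom ≫
      eqToHom (congrArg₂ (· ⊗ ·) k h).symm := by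
  subst h k; simp

lemma copy_eqToHom [CopyDiscardCategory D] {X X' : D} (h : X = X') :
    Δ[X] = eqToHom h ≫ Δ[X'] ≫ eqToHom (congrArg₂ (· ⊗ ·) h h).symm := by
  subst h; simp

lemma discard_eqToHom [CopyDiscardCategory D] {X X' : D} (h : X = X') :
    ε[X] = eqToHom h ≫ ε[X'] := by
  subst h; simp

variable [StrictMonoidalCategory D]

/-- In a strict category the associator is an `eqToHom`, so this is its naturality. The products
enter as free variables with equations, so that `subst` can remove the casts; in use they are values
of a functor on concatenated lists, equal to tensor products only propositionally. -/
lemma tensorHom_assoc_eqToHom {X Y Z X' Y' Z' A B T U A' B' T' U' : D} (f : X ⟶ X') (g : Y ⟶ Y')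
    (h : Z ⟶ Z') (hA : A = X ⊗ Y) (hB : B = Y ⊗ Z) (hT : T = A ⊗ Z) (hU : U = X ⊗ B)
    (hA' : A' = X' ⊗ Y') (hB' : B' = Y' ⊗ Z') (hT' : T' = A' ⊗ Z') (hU' : U' = X' ⊗ B')
    (e : T = U) (e' : T' = U') :
    (eqToHom hT ≫ ((eqToHom hA ≫ (f ⊗ₘ g) ≫ eqToHom hA'.symm) ⊗ₘ h) ≫ eqToHom hT'.symm) ≫
      eqToHom e' =
    eqToHom e ≫ eqToHom hU ≫ (f ⊗ₘ (eqToHom hB ≫ (g ⊗ₘ h) ≫ eqToHom hB'.symm)) ≫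
      eqToHom hU'.symm := by
  subst hA hB hT hU hA' hB' hT' hU'
  have := associator_naturality f g h
  simpa only [StrictMonoidalCategory.associator_hom, eqToHom_refl, Category.id_comp,
    Category.comp_id] using this

lemma unit_tensorHom_eqToHom {X X' I T T' : D} (f : X ⟶ X') (hI : I = 𝟙_ D) (hT : T = I ⊗ X)
    (hT' : T' = I ⊗ X') (e : T = X) (e' : T' = X') :
    (eqToHom hT ≫ (𝟙 I ⊗ₘ f) ≫ eqToHom hT'.symm) ≫ eqToHom e' = eqToHom e ≫ f := by
  subst hI hT hT'
  have := leftUnitor_naturality f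
  simpa only [StrictMonoidalCategory.leftUnitor_hom, eqToHom_refl, Category.id_comp,
    Category.comp_id, id_tensorHom] using this

lemma tensorHom_unit_eqToHom {X X' I T T' : D} (f : X ⟶ X') (hI : I = 𝟙_ D) (hT : T = X ⊗ I)
    (hT' : T' = X' ⊗ I) (e : T = X) (e' : T' = X') :
    (eqToHom hT ≫ (f ⊗ₘ 𝟙 I) ≫ eqToHom hT'.symm) ≫ eqToHom e' = eqToHom e ≫ f := by
  subst hI hT hT'
  have := rightUnitor_naturality f
  simpa only [StrictMonoidalCategory.rightUnitor_hom, eqToHom_refl, Category.id_comp,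
    Category.comp_id, tensorHom_id] using this

end EqToHom

/-! ### Reassigning the boxes of a strict Markov functor -/

/-- A diagram without boxes. -/
def Diagram.BoxFree {S : MonoidalSignature.{w, w'}} :
    ∀ {a b : List S.W}, Diagram S a b → Prop
  | _, _, .box _ => False
  | _, _, .comp f g => f.BoxFree ∧ g.BoxFree
  | _, _, .tensor f g => f.BoxFree ∧ g.BoxFree
  | _, _, _ => True

namespace StrictMarkovFunctor

variable {S : MonoidalSignature.{w, w'}} {D : Type u} [Category.{v} D] [MonoidalCategory D]
  [MarkovCategory D] (F : StrictMarkovFunctor (FreeMarkov S) D)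
  (β : ∀ b : S.B, F.obj ⟨S.dom b⟩ ⟶ F.obj ⟨S.cod b⟩)

/-- The value of a diagram when the boxes are reinterpreted by `β` and the wires and structure maps
are interpreted by `F`. -/
noncomputable def interp : ∀ {a b : List S.W}, Diagram S a b → (F.obj ⟨a⟩ ⟶ F.obj ⟨b⟩)
  | _, _, .box b => β b
  | _, _, .cast h => eqToHom (by rw [h])
  | _, _, .comp f g => interp f ≫ interp g
  | _, _, .tensor (a := a) (b := b) (c := c) (d := d) f g =>
      eqToHom (F.obj_tensor ⟨a⟩ ⟨c⟩) ≫ (interp f ⊗ₘ interp g) ≫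
        eqToHom (F.obj_tensor ⟨b⟩ ⟨d⟩).symm
  | _, _, .swap a b => F.map (β_ (⟨a⟩ : FreeMarkov S) ⟨b⟩).hom
  | _, _, .copy a => F.map Δ[(⟨a⟩ : FreeMarkov S)]
  | _, _, .discard a => F.map ε[(⟨a⟩ : FreeMarkov S)]

/-- The new values `β` enter only at boxes. Swaps, copies and discards are interpreted as images
under `F`, so those cases hold by definition, and the rest is functoriality and `map_tensor`. -/
lemma interp_of_boxFree {a b : List S.W} (d : Diagram S a b) (hd : d.BoxFree) :
    F.interp β d = F.map (FreeMarkov.of d) := by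
  induction d with
  | box b => exact hd.elim
  | cast h => rw [FreeMarkov.of_cast, eqToHom_map]; rfl
  | comp f g hf hg =>
    rw [← FreeMarkov.of_comp, F.map_comp, ← hf hd.1, ← hg hd.2]; rfl
  | tensor f g hf hg =>
    rw [← FreeMarkov.of_tensor, F.map_tensor, ← hf hd.1, ← hg hd.2]; rfl
  | swap a b => rfl
  | copy a => rfl
  | discard a => rfl

/-- Related diagrams are equal in the free category, hence have equal images under `F`. This
disposes of the symmetry and comonoid axioms without checking them in `D`. -/
lemma interp_eq_of_boxFree {a b : List S.W} {d d' : Diagram S a b} (h : Diagram.Rel d d')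
    (hd : d.BoxFree) (hd' : d'.BoxFree) : F.interp β d = F.interp β d' := by
  rw [interp_of_boxFree _ _ _ hd, interp_of_boxFree _ _ _ hd']
  exact congrArg _ (Quot.sound h)

lemma interp_eq_of_rel [StrictMonoidalCategory D] {a b : List S.W} {d d' : Diagram S a b}
    (h : Diagram.Rel d d') : F.interp β d = F.interp β d' := by
  induction h with
  | comp_left h g ih => simp only [interp, ih]
  | comp_right f h ih => simp only [interp, ih]
  | tensor_left h g ih => simp only [interp, ih]
  | tensor_right f h ih => simp only [interp, ih]
  | id_comp f => exact Category.id_comp _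
  | comp_id f => exact Category.comp_id _
  | assoc f g h => exact Category.assoc _ _ _
  | tensor_comp f g f' g' => simp [interp]
  -- Strictness of `D` enters in this case and the two unit cases: the casts between lists must act
  -- as associators and unitors.
  | tensor_assoc f g h =>
    exact tensorHom_assoc_eqToHom _ _ _ _ _ _ _ (F.obj_tensor _ _)
      (F.obj_tensor _ _) (F.obj_tensor _ _) (F.obj_tensor _ _) _ _
  | unit_tensor f => exact unit_tensorHom_eqToHom _ F.obj_unit _ (F.obj_tensor (𝟙_ _) _) _ _
  | tensor_unit f => exact tensorHom_unit_eqToHom _ F.obj_unit _ (F.obj_tensor _ (𝟙_ _)) _ _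
  | swap_natural f g => simp [interp, F.map_braiding]
  | discard_natural f => simp [interp, F.map_discard]
  -- Both sides begin with `copy a`, so the congruence rule `comp_right` also fits and the
  -- constructor has to be named.
  | copy_assoc a =>
    refine F.interp_eq_of_boxFree β (.copy_assoc a) ?_ ?_ <;> simp [Diagram.BoxFree]
  -- The remaining axioms relate specific structural diagrams, with no boxes on either side.
  | tensor_id | swap_swap | hexagon_forward | hexagon_reverse | copy_discard_left
  | copy_discard_right | copy_comm | copy_tensor | copy_unit | discard_unit =>
    refine F.interp_eq_of_boxFree β (by constructor) ?_ ?_ <;>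
      simp [Diagram.BoxFree, Diagram.exchange]

/-- The strict Markov functor which agrees with `F` on objects and is given by `β` on boxes. -/
noncomputable def reinterpret [StrictMonoidalCategory D] :
    StrictMarkovFunctor (FreeMarkov S) D where
  obj := F.obj
  map := Quot.lift (F.interp β) fun _ _ h => F.interp_eq_of_rel β h
  map_id X := rfl
  map_comp f g := by
    obtain ⟨f, rfl⟩ := FreeMarkov.of_surj f
    obtain ⟨g, rfl⟩ := FreeMarkov.of_surj g
    rfl
  obj_unit := F.obj_unit
  obj_tensor := F.obj_tensor
  map_tensor f g := by
    obtain ⟨f, rfl⟩ := FreeMarkov.of_surj f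
    obtain ⟨g, rfl⟩ := FreeMarkov.of_surj g
    rfl
  map_braiding := F.map_braiding
  map_copy := F.map_copy
  map_discard := F.map_discard

/-- Besides the boxes, every constructor is something a strict Markov functor preserves, so each
case compares the preservation laws of `G` and `G'`. The objects agree only propositionally, whence
the conjugation by casts. -/
lemma map_of_eq {G G' : StrictMarkovFunctor (FreeMarkov S) D} (hobj : ∀ X, G.obj X = G'.obj X)
    (hbox : ∀ b, G.map (FreeMarkov.box b) =
      eqToHom (hobj _) ≫ G'.map (FreeMarkov.box b) ≫ eqToHom (hobj _).symm)
    {a b : List S.W} (d : Diagram S a b) :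
    G.map (FreeMarkov.of d) =
      eqToHom (hobj _) ≫ G'.map (FreeMarkov.of d) ≫ eqToHom (hobj _).symm := by
  induction d with
  | box b => exact hbox b
  | cast h => simp [FreeMarkov.of_cast, eqToHom_map]
  | comp f g hf hg => simp [← FreeMarkov.of_comp, hf, hg]
  | tensor f g hf hg =>
    simp only [← FreeMarkov.of_tensor, map_tensor, hf, hg, ← tensorHom_comp_tensorHom,
      eqToHom_tensorHom_eqToHom, Category.assoc, eqToHom_trans, eqToHom_trans_assoc]
  | swap a b =>
    refine (G.map_braiding ⟨a⟩ ⟨b⟩).trans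
      (Eq.trans ?_ (congrArg (fun t => _ ≫ t ≫ _) (G'.map_braiding ⟨a⟩ ⟨b⟩)).symm)
    rw [braiding_eqToHom (hobj ⟨a⟩) (hobj ⟨b⟩)]
    simp only [Category.assoc, eqToHom_trans, eqToHom_trans_assoc]
  | copy a =>
    refine (G.map_copy ⟨a⟩).trans
      (Eq.trans ?_ (congrArg (fun t => _ ≫ t ≫ _) (G'.map_copy ⟨a⟩)).symm)
    rw [copy_eqToHom (hobj ⟨a⟩)]
    simp only [Category.assoc, eqToHom_trans]
  | discard a =>
    refine (G.map_discard ⟨a⟩).trans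
      (Eq.trans ?_ (congrArg (fun t => _ ≫ t ≫ _) (G'.map_discard ⟨a⟩)).symm)
    rw [discard_eqToHom (hobj ⟨a⟩)]
    simp only [Category.assoc, eqToHom_trans]

/-- All the fields beyond the underlying functor are propositions. -/
lemma toFunctor_injective :
    Function.Injective (toFunctor : StrictMarkovFunctor (FreeMarkov S) D → _) := by
  rintro ⟨G, _⟩ ⟨G', _⟩ h
  cases h
  rfl

/-- Strict Markov functors out of a free Markov category are determined by their values on objects
and boxes. -/
lemma ext_of_box {G G' : StrictMarkovFunctor (FreeMarkov S) D} (hobj : ∀ X, G.obj X = G'.obj X)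
    (hbox : ∀ b, G.map (FreeMarkov.box b) =
      eqToHom (hobj _) ≫ G'.map (FreeMarkov.box b) ≫ eqToHom (hobj _).symm) : G = G' :=
  toFunctor_injective (CategoryTheory.Functor.ext hobj fun X Y f => by
    obtain ⟨d, rfl⟩ := FreeMarkov.of_surj f
    exact map_of_eq hobj hbox d)

end StrictMarkovFunctor

/-! ### The counterfactual functor -/

namespace JointFactorization

variable {S : MonoidalSignature.{w, w'}} {P : ObjectProperty Stoch.{0}} [P.IsMonoidal] {M : Type u}
  [Category.{v} M] [MonoidalCategory M] [MarkovCategory M] (𝓕 : JointFactorization S M)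
  (J : KernelInclusion P M)
  (g : ∀ b : S.B, J.incl.obj J.interval ⊗ (𝓕.F.obj ⟨S.dom b⟩).obj ⟶ (𝓕.F.obj ⟨𝓕.res b⟩).obj)
  (iv : 𝓕.Intervention) (U : S.B → unitInterval)

lemma isCounterfactual_reinterpret [StrictMonoidalCategory M] :
    𝓕.IsCounterfactual J g iv U (𝓕.F.reinterpret (𝓕.counterfactualBox J g iv U)) where
  obj_eq _ := rfl
  map_box _ := ((Category.id_comp _).trans (Category.comp_id _)).symm

variable {𝓕 J g iv U} in
-- On each box both functors are the same counterfactual kernel up to casts, so they agree on boxes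
-- and `ext_of_box` applies.
lemma IsCounterfactual.eq {If If' : StrictMarkovFunctor (FreeMarkov S) (Joint M)}
    (h : 𝓕.IsCounterfactual J g iv U If) (h' : 𝓕.IsCounterfactual J g iv U If') : If = If' :=
  StrictMarkovFunctor.ext_of_box (fun X => (h.obj_eq X).trans (h'.obj_eq X).symm) fun b => by
    rw [h.map_box, h'.map_box]
    simp only [Category.assoc, eqToHom_trans, eqToHom_trans_assoc]

end JointFactorization
end CausalDiagram

theorem mainTheorem6 {M : Type*} [Category M] [MonoidalCategory M] [MarkovCategory M]
    [StrictMonoidalCategory M] {P : ObjectProperty Stoch.{0}} [P.IsMonoidal]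
    (J : KernelInclusion P M) (S : MonoidalSignature) (𝓕 : JointFactorization S M)
    (hnoise : ∀ b : S.B, J.IsStandardBorelKernel (𝓕.noise b)) :
    (∃ g, 𝓕.IsRandomization J g) ∧
    ∀ g, 𝓕.IsRandomization J g → ∀ (iv : 𝓕.Intervention) (U : S.B → unitInterval),
      (∃! If : StrictMarkovFunctor (FreeMarkov S) (Joint M), 𝓕.IsCounterfactual J g iv U If) ∧
      (∃! D : 𝓕.F.obj 𝓕.dom ⟶ 𝓕.F.obj 𝓕.cod,
        ∀ (If : StrictMarkovFunctor (FreeMarkov S) (Joint M))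
          (hIf : 𝓕.IsCounterfactual J g iv U If),
          D = eqToHom (hIf.obj_eq 𝓕.dom).symm ≫ If.map 𝓕.φ ≫ eqToHom (hIf.obj_eq 𝓕.cod)) := by
  refine ⟨?_, fun g _ iv U => ?_⟩
  · choose g hdet hfeed using fun b => (hnoise b).exists_feed_uniform_eq
    exact ⟨g, hdet, hfeed⟩
  · have hIf := 𝓕.isCounterfactual_reinterpret J g iv U
    -- The witness for `D` is left to unification: the uniqueness clause, applied to the constructed
    -- functor, fixes it as the image of `φ`. That the functor exists is what makes the condition on
    -- `D` nonvacuous; that it is unique makes `D` independent of `If`.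
    refine ⟨⟨_, hIf, fun If h => h.eq hIf⟩, _, fun If h => ?_, fun D hD => hD _ hIf⟩
    obtain rfl := hIf.eq h
    rfl
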